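/- **Setting.** Let $(\Omega,\mathcal F,\mathbb P;(\mathcal F_t)_{t=0}^T)$ be a finite filtered probability space with $\mathcal F_0=\{\emptyset,\Omega\}$, $\mathcal F_T=\mathcal F=2^\Omega$ and $\mathbb P(\{\omega\})>0$ for all $\omega$. Let $\Omega_t$ be the set of atoms (nodes) of $\mathcal F_t$; the successors of $\mu\in\Omega_t$ are the $\nu\in\Omega_{t+1}$ with $\nu\subseteq\mu$. Let $\mathcal L_t$ be the set of $\mathcal F_t$-measurable maps $\Omega\to\mathbb R^d$, which are identified with functions on $\Omega_t$; for $A\subseteq\mathcal L_t$ and $\mu\in\Omega_t$ put $A^\mu=\{z^\mu \mid z\in A\}\subseteq\mathbb R^d$. There are $d$ currencies; at time $t$ one unit of currency $k$ is obtained for $\pi^{jk}_t>0$ units of currency $j$, where $\pi^{jk}_t$ is $\mathcal F_t$-measurable and $\pi^{jj}_t=1$. The solvency cone $\mathcal K_t$ is the set of $x\in\mathcal L_t$ for which there are $\mathcal F_t$-measurable $\beta^{jk}\ge0$ with $x^k+\sum_j\beta^{jk}-\sum_j\beta^{kj}\pi^{kj}_t\ge0$ for all $k$. A trading strategy is a sequence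 $y=(y_t)_{t=0}^{T+1}$ with $y_0\in\mathbb R^d$, $y_t\in\mathcal L_{t-1}$ for $t\ge1$ and $y_{T+1}=0$. Assume that there is no arbitrage opportunity, that is, no trading strategy $y$ with $y_0=0$, $y_t-y_{t+1}\in\mathcal K_t$ for all $t<T$, and $y_T-x\in\mathcal K_T$ for some $x\in\mathcal L_T\setminus\{0\}$ with non-negative components. A mixed stopping time is an adapted $[0,1]$-valued process $\chi=(\chi_t)_{t=0}^T$ with $\sum_{t=0}^T\chi_t=1$; $\mathcal X$ is the set of these. For an adapted process $X$ put $X_\chi=\sum_{s=0}^T\chi_sX_s$, $X^{\chi*}_t=\sum_{s=t}^T\chi_sX_s$ for $t\le T$, and $X^{\chi*}_{T+1}=0$. Let $\xi=(\xi_t)_{t=0}^T$ be an adapted $\mathbb R^d$-valued process (the payoff) and let $j\in\{1,\dots,d\}$, with $e^j$ the $j$-th unit vector. The seller's price of the American option $\xi$ with gradual exercise is $$\pi^{\mathrm{ag}}_j(\xi)=\inf\{x\in\mathbb R \mid xe^j=Y_0\},$$ where $Y$ runs over the maps $\chi\mapsto Y^\chi$ from $\mathcal X$ to the trading strategies such that,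 for all $\chi,\chi'\in\mathcal X$ and $t\le T$, $Y^\chi_t-\chi_t\xi_t-Y^\chi_{t+1}\in\mathcal K_t$, and $Y^\chi_t(\omega)=Y^{\chi'}_t(\omega)$ for every $\omega$ with $\chi_s(\omega)=\chi'_s(\omega)$ for all $s<t$; here $Y_0$ is the common value of the $Y^\chi_0$. The deferred solvency cone $\mathcal Q_t$ is the set of $z\in\mathcal L_t$ for which there are $y_s\in\mathcal L_{s-1}$ ($s=t+1,\dots,T$) and $y_{T+1}=0$ with $z-y_{t+1}\in\mathcal K_t$ and $y_s-y_{s+1}\in\mathcal K_s$ for $s=t+1,\dots,T$. Let $\mathcal U_t=\xi_t+\mathcal Q_t$ for $t\le T$, $\mathcal Z_T=\mathcal V_T=\mathcal W_T=\mathcal U_T$ and, for $t=T-1,\dots,0$, $\mathcal W_t=\mathcal Z_{t+1}\cap\mathcal L_t$, $\mathcal V_t=\mathcal W_t+\mathcal Q_t$, $\mathcal Z_t=\mathcal U_t\cap\mathcal V_t$. Let $U_t^\mu,V_t^\mu,W_t^\mu,Z_t^\mu$ be the support functions of $-\mathcal U_t^\mu,-\mathcal V_t^\mu,-\mathcal W_t^\mu,-\mathcal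 Z_t^\mu$, with values in $\mathbb R\cup\{\infty\}$, where the support function of $A\subseteq\mathbb R^d$ is $y\mapsto\sup\{y\cdot a\mid a\in A\}$; write $Z^{\mathrm{ad}}_0=Z_0^{\Omega}$. For $A\subseteq\mathbb R^d$ let $A^*=\{y\mid y\cdot x\ge0\text{ for all }x\in A\}$ and $\sigma_j(A)=\{x\in A\mid x^j=1\}$; conditions such as $S_t\in\mathcal Q_t^*$ are understood nodewise, $S_t^\mu\in(\mathcal Q_t^\mu)^*=:\mathcal Q_t^{\mu*}$. **Statement.** The maximum below is attained, and $$\pi^{\mathrm{ag}}_j(\xi)=\max\{-Z^{\mathrm{ad}}_0(s)\mid s\in\sigma_j(\mathbb R^d)\}=\mathbb E_{\mathbb Q}\big((\xi\cdot S)_\chi\big)$$ for some mixed stopping time $\chi\in\mathcal X$, probability measure $\mathbb Q$ and adapted $\mathbb R^d$-valued process $S$ such that, for all $t=0,\dots,T$, $$S_t\in\mathcal Q_t^*\setminus\{0\},\qquad \mathbb E_{\mathbb Q}(S^{\chi*}_{t+1}\mid\mathcal F_t)\in\mathcal Q_t^*\ \ \mathbb Q\text{-a.s.},\qquad S_t^j=1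 .$$ Such $\chi,\mathbb Q,S$ can be constructed by the following recursive procedure: it can be started, each of its steps can be carried out whatever the earlier choices were, and every output $(\chi,\mathbb Q,S)$ of it has all the properties above, including $\pi^{\mathrm{ag}}_j(\xi)=\mathbb E_{\mathbb Q}((\xi\cdot S)_\chi)$. * Start: choose $y_0\in\sigma_j(\mathcal Q_0^*)$ at which $-Z^{\mathrm{ad}}_0$ attains its maximum over $\sigma_j(\mathbb R^d)$. * Step: for $t<T$, $\mu\in\Omega_t$ and the given $y^\mu_t\in\sigma_j(\mathcal Q_t^{\mu*})$, choose $\lambda^\mu_t\in[0,1]$, $x^\mu_t\in\sigma_j(\{V^\mu_t<\infty\})$, $S^\mu_t\in\sigma_j(\mathcal Q_t^{\mu*})$ and, for each successor $\nu$ of $\mu$, $q^\nu_{t+1}\in[0,1]$ and $y^\nu_{t+1}\in\sigma_j(\mathcal Q^{\nu*}_{t+1})$, such that $y^\mu_t=\lambda^\mu_tS^\mu_t+(1-\lambda^\mu_t)x^\mu_t$, $Z^\mu_t(y^\mu_t)=\lambda^\mu_tU^\mu_t(S^\mu_t)+(1-\lambda^\mu_t)V^\mu_t(x^\mu_t)$,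 $\sum_\nu q^\nu_{t+1}=1$, $x^\mu_t=\sum_\nu q^\nu_{t+1}y^\nu_{t+1}$ and $V^\mu_t(x^\mu_t)=W^\mu_t(x^\mu_t)=\sum_\nu q^\nu_{t+1}Z^\nu_{t+1}(y^\nu_{t+1})$. * End: $\lambda^\mu_T=1$ and $x^\mu_T=S^\mu_T=y^\mu_T$ for $\mu\in\Omega_T$. * Output: $S$, the measure $\mathbb Q$ with $\mathbb Q(\{\omega\})=\prod_{t=1}^Tq_t^{\mu_t(\omega)}$, where $\mu_t(\omega)\in\Omega_t$ is the node containing $\omega$, and $\chi_t=\lambda_t\big(1-\sum_{s<t}\chi_s\big)$ for $t=0,\dots,T$. -/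

import Mathlib

open MeasureTheory
open scoped Pointwise

noncomputable section

/-- `σ_j(A)`: the elements of `A` whose `j`-th coordinate is `1`. -/
def sigmaSet {d : ℕ} (j : Fin d) (A : Set (Fin d → ℝ)) : Set (Fin d → ℝ) :=
  {x | x ∈ A ∧ x j = 1}

/-- `A^*`: the polar of `-A`. -/
def polarNeg {d : ℕ} (A : Set (Fin d → ℝ)) : Set (Fin d → ℝ) :=
  {y | ∀ x ∈ A, 0 ≤ y ⬝ᵥ x}

/-- The support function of a set, with values in the extended reals. -/
def supportFun {d : ℕ} (A : Set (Fin d → ℝ)) (y : Fin d → ℝ) : EReal :=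
  ⨆ a ∈ A, ((y ⬝ᵥ a : ℝ) : EReal)

/-- The section `A^μ` at a node `μ`: the values on `μ` of those elements of `A`
that are constant on `μ`. -/
def nodeSection {Ω : Type*} {d : ℕ} (A : Set (Ω → Fin d → ℝ)) (μ : Set Ω) :
    Set (Fin d → ℝ) :=
  {v | ∃ z ∈ A, ∀ ω ∈ μ, z ω = v}

/-- The process `X` evaluated at the mixed stopping time `χ`, that is `X_χ`, for a real process. -/
def evalAt {Ω : Type*} (T : ℕ) (χ X : ℕ → Ω → ℝ) (ω : Ω) : ℝ :=
  ∑ s ∈ Finset.Icc 0 T, χ s ω * X s ω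

/-- `X^{χ*}_t = ∑_{s=t}^T χ_s X_s`; the sum is empty for `t = T + 1`. -/
def tailSum {Ω : Type*} {d : ℕ} (T : ℕ) (χ : ℕ → Ω → ℝ) (X : ℕ → Ω → Fin d → ℝ)
    (t : ℕ) (ω : Ω) : Fin d → ℝ :=
  ∑ s ∈ Finset.Icc t T, χ s ω • X s ω

/-- The multi-currency model with proportional transaction costs, with `d` currencies and
time horizon `T`, on a finite filtered probability space.
One unit of currency `k` costs `rate t j k` units of currency `j` at time `t`.
Only the times `t ≤ T` matter. -/
structure CurrencyModel (Ω : Type*) [Finite Ω] [MeasurableSpace Ω] (T d : ℕ) where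
  P : Measure Ω
  isProbabilityMeasure_P : IsProbabilityMeasure P
  P_pos : ∀ ω, 0 < P {ω}
  filt : Filtration ℕ ‹MeasurableSpace Ω›
  filt_zero : filt 0 = ⊥
  filt_final : filt T = ⊤
  rate : ℕ → Fin d → Fin d → Ω → ℝ
  rate_pos : ∀ t ≤ T, ∀ j k ω, 0 < rate t j k ω
  rate_self : ∀ t ≤ T, ∀ j ω, rate t j j ω = 1
  rate_measurable : ∀ t ≤ T, ∀ j k, Measurable[filt t] (rate t j k)

namespace CurrencyModel

variable {Ω : Type*} [Finite Ω] [MeasurableSpace Ω] {T d : ℕ}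

/-- `𝓛_t`: the portfolios that are known at time `t`. -/
def portfolios (M : CurrencyModel Ω T d) (t : ℕ) : Set (Ω → Fin d → ℝ) :=
  {x | Measurable[M.filt t] x}

/-- The portfolio `x` can be exchanged into the portfolio `y` at time `t`;
`β j k` is the number of units of currency `k` received for currency `j`. -/
def CanExchange (M : CurrencyModel Ω T d) (t : ℕ) (x y : Ω → Fin d → ℝ) : Prop :=
  ∃ β : Fin d → Fin d → Ω → ℝ,
    (∀ j k, Measurable[M.filt t] (β j k)) ∧ (∀ j k ω, 0 ≤ β j k ω) ∧
    ∀ ω k, y ω k = x ω k + ∑ j, β j k ω - ∑ j, β k j ω * M.rate t k j ω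

/-- The solvency cone `𝓚_t`. -/
def solvencyCone (M : CurrencyModel Ω T d) (t : ℕ) : Set (Ω → Fin d → ℝ) :=
  {x | x ∈ M.portfolios t ∧ ∃ y ∈ M.portfolios t, M.CanExchange t x y ∧ ∀ ω k, 0 ≤ y ω k}

/-- `Φ`: the trading strategies `y_0, …, y_{T+1}` (later values are irrelevant).
Since `𝓕_0` is trivial, `y_0` is deterministic. -/
def IsStrategy (M : CurrencyModel Ω T d) (y : ℕ → Ω → Fin d → ℝ) : Prop :=
  y 0 ∈ M.portfolios 0 ∧ (∀ t ≤ T, y (t + 1) ∈ M.portfolios t) ∧ y (T + 1) = 0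

/-- An arbitrage opportunity. -/
def IsArbitrage (M : CurrencyModel Ω T d) (y : ℕ → Ω → Fin d → ℝ) : Prop :=
  M.IsStrategy y ∧ (∀ t < T, y t - y (t + 1) ∈ M.solvencyCone t) ∧ y 0 = 0 ∧
    ∃ x ∈ M.portfolios T, x ≠ 0 ∧ (∀ ω k, 0 ≤ x ω k) ∧ y T - x ∈ M.solvencyCone T

def NoArbitrage (M : CurrencyModel Ω T d) : Prop :=
  ¬ ∃ y, M.IsArbitrage y

/-- An adapted `ℝ^d`-valued process on the times `0, …, T`. -/
def IsAdapted (M : CurrencyModel Ω T d) (X : ℕ → Ω → Fin d → ℝ) : Prop :=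
  ∀ t ≤ T, X t ∈ M.portfolios t

/-- `χ` is a mixed stopping time (values after time `T` are irrelevant). -/
def IsMixedStoppingTime (M : CurrencyModel Ω T d) (χ : ℕ → Ω → ℝ) : Prop :=
  (∀ t ≤ T, Measurable[M.filt t] (χ t)) ∧ (∀ t ≤ T, ∀ ω, χ t ω ∈ Set.Icc (0 : ℝ) 1) ∧
    ∀ ω, ∑ t ∈ Finset.Icc 0 T, χ t ω = 1

/-- `Φ^ag(ξ)`: the seller's superhedging strategies against gradual exercise. Only the values
of `Y` at mixed stopping times matter. -/
def IsSellerHedge (M : CurrencyModel Ω T d) (ξ : ℕ → Ω → Fin d → ℝ)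
    (Y : (ℕ → Ω → ℝ) → ℕ → Ω → Fin d → ℝ) : Prop :=
  (∀ χ, M.IsMixedStoppingTime χ → M.IsStrategy (Y χ)) ∧
  (∀ χ, M.IsMixedStoppingTime χ → ∀ t ≤ T,
    Y χ t - (fun ω => χ t ω • ξ t ω) - Y χ (t + 1) ∈ M.solvencyCone t) ∧
  (∀ χ χ', M.IsMixedStoppingTime χ → M.IsMixedStoppingTime χ' → ∀ t ≤ T, ∀ ω,
    (∀ s < t, χ s ω = χ' s ω) → Y χ t ω = Y χ' t ω)

/-- `π^ag_j(ξ)`: the ask price in currency `j` under gradual exercise, as an infimum in the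
extended reals. -/
def askPrice (M : CurrencyModel Ω T d) (ξ : ℕ → Ω → Fin d → ℝ) (j : Fin d) : EReal :=
  sInf {r | ∃ x : ℝ, r = (x : EReal) ∧ ∃ Y, M.IsSellerHedge ξ Y ∧
    ∀ χ, M.IsMixedStoppingTime χ → ∀ ω, Y χ 0 ω = Pi.single j x}

/-- The deferred solvency cone `𝓠_t`; `y_{t+1}, …, y_{T+1}` is a liquidation strategy. -/
def deferredCone (M : CurrencyModel Ω T d) (t : ℕ) : Set (Ω → Fin d → ℝ) :=
  {z | z ∈ M.portfolios t ∧ ∃ y : ℕ → Ω → Fin d → ℝ,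
    (∀ s, t ≤ s → s < T → y (s + 1) ∈ M.portfolios s) ∧
    z - y (t + 1) ∈ M.solvencyCone t ∧
    (∀ s, t < s → s ≤ T → y s - y (s + 1) ∈ M.solvencyCone s) ∧ y (T + 1) = 0}

/-- `𝓤^ad_t`. -/
def Uset (M : CurrencyModel Ω T d) (ξ : ℕ → Ω → Fin d → ℝ) (t : ℕ) : Set (Ω → Fin d → ℝ) :=
  {ξ t} + M.deferredCone t

/-- `𝓩^ad_t`, by backward induction from time `T`. -/
def Zset (M : CurrencyModel Ω T d) (ξ : ℕ → Ω → Fin d → ℝ) (t : ℕ) : Set (Ω → Fin d → ℝ) :=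
  if t < T then
    M.Uset ξ t ∩ ((M.Zset ξ (t + 1) ∩ M.portfolios t) + M.deferredCone t)
  else M.Uset ξ t
termination_by T - t

/-- `𝓦^ad_t`. -/
def Wset (M : CurrencyModel Ω T d) (ξ : ℕ → Ω → Fin d → ℝ) (t : ℕ) : Set (Ω → Fin d → ℝ) :=
  if t < T then M.Zset ξ (t + 1) ∩ M.portfolios t else M.Uset ξ t

/-- `𝓥^ad_t`. -/
def Vset (M : CurrencyModel Ω T d) (ξ : ℕ → Ω → Fin d → ℝ) (t : ℕ) : Set (Ω → Fin d → ℝ) :=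
  if t < T then M.Wset ξ t + M.deferredCone t else M.Uset ξ t

/-- The node at time `t` that contains `ω`: the atom of `𝓕_t` around `ω`. -/
def node (M : CurrencyModel Ω T d) (t : ℕ) (ω : Ω) : Set Ω :=
  @measurableAtom Ω (M.filt t) ω

/-- `Ω_t`: the nodes at time `t`. -/
def nodes (M : CurrencyModel Ω T d) (t : ℕ) : Set (Set Ω) :=
  Set.range (M.node t)

/-- The successors of a node `μ` at time `t`. -/
def successors (M : CurrencyModel Ω T d) (t : ℕ) (μ : Set Ω) : Finset (Set Ω) :=
  (Set.toFinite {ν | ν ∈ M.nodes (t + 1) ∧ ν ⊆ μ}).toFinset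

/-- `𝓠^{μ*}_t`. -/
def dualCone (M : CurrencyModel Ω T d) (t : ℕ) (μ : Set Ω) : Set (Fin d → ℝ) :=
  polarNeg (nodeSection (M.deferredCone t) μ)

/-- The support functions at a node of the negatives of the four sets. -/
def Ufun (M : CurrencyModel Ω T d) (ξ : ℕ → Ω → Fin d → ℝ) (t : ℕ) (μ : Set Ω) :
    (Fin d → ℝ) → EReal :=
  supportFun (-(nodeSection (M.Uset ξ t) μ))

def Vfun (M : CurrencyModel Ω T d) (ξ : ℕ → Ω → Fin d → ℝ) (t : ℕ) (μ : Set Ω) :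
    (Fin d → ℝ) → EReal :=
  supportFun (-(nodeSection (M.Vset ξ t) μ))

def Wfun (M : CurrencyModel Ω T d) (ξ : ℕ → Ω → Fin d → ℝ) (t : ℕ) (μ : Set Ω) :
    (Fin d → ℝ) → EReal :=
  supportFun (-(nodeSection (M.Wset ξ t) μ))

def Zfun (M : CurrencyModel Ω T d) (ξ : ℕ → Ω → Fin d → ℝ) (t : ℕ) (μ : Set Ω) :
    (Fin d → ℝ) → EReal :=
  supportFun (-(nodeSection (M.Zset ξ t) μ))

/-- The set of values `-Z^ad_0(s)` for `s ∈ σ_j(ℝ^d)`; the only node at time `0` is `Ω`. -/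
def dualValues (M : CurrencyModel Ω T d) (ξ : ℕ → Ω → Fin d → ℝ) (j : Fin d) : Set EReal :=
  (fun s => -M.Zfun ξ 0 Set.univ s) '' sigmaSet j Set.univ

/-- `χ` is a mixed stopping time, `Q` is a probability measure and `S` is an adapted process
with `S^j = 1` satisfying the deferred solvency dual conditions. -/
structure IsDualTriple (M : CurrencyModel Ω T d) (j : Fin d) (χ : ℕ → Ω → ℝ) (Q : Measure Ω)
    (S : ℕ → Ω → Fin d → ℝ) : Prop where
  mixed : M.IsMixedStoppingTime χ
  prob : IsProbabilityMeasure Q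
  adapted : M.IsAdapted S
  mem_dualCone : ∀ t ≤ T, ∀ ω, S t ω ∈ M.dualCone t (M.node t ω) \ {0}
  condExp_mem : ∀ t ≤ T, ∀ᵐ ω ∂Q,
    (Q[tailSum T χ S (t + 1) | M.filt t]) ω ∈ M.dualCone t (M.node t ω)
  unit : ∀ t ≤ T, ∀ ω, S t ω j = 1

/-- First step of the recursive procedure: `y` is an element of `σ_j(𝓠^*_0)` at which `-Z^ad_0`
is maximal on `σ_j(ℝ^d)`. -/
def IsInitialChoice (M : CurrencyModel Ω T d) (ξ : ℕ → Ω → Fin d → ℝ) (j : Fin d)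
    (y : Fin d → ℝ) : Prop :=
  y ∈ sigmaSet j (M.dualCone 0 Set.univ) ∧
    ∀ s ∈ sigmaSet j Set.univ, -M.Zfun ξ 0 Set.univ s ≤ -M.Zfun ξ 0 Set.univ y

/-- Recursive step at a node `μ` at time `t < T`: the vector `y` at `μ` is split into `S` and `x`
with weight `l`, and `x` is split into vectors `y' ν` at the successors `ν` of `μ`
with weights `q ν`. -/
structure IsStep (M : CurrencyModel Ω T d) (ξ : ℕ → Ω → Fin d → ℝ) (j : Fin d) (t : ℕ)
    (μ : Set Ω) (y : Fin d → ℝ) (l : ℝ) (x S : Fin d → ℝ) (q : Set Ω → ℝ)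
    (y' : Set Ω → Fin d → ℝ) : Prop where
  l_mem : l ∈ Set.Icc (0 : ℝ) 1
  x_mem : x ∈ sigmaSet j {v | M.Vfun ξ t μ v < ⊤}
  S_mem : S ∈ sigmaSet j (M.dualCone t μ)
  Z_eq : M.Zfun ξ t μ y = (l : EReal) * M.Ufun ξ t μ S + ((1 - l : ℝ) : EReal) * M.Vfun ξ t μ x
  y_eq : y = l • S + (1 - l) • x
  q_mem : ∀ ν ∈ M.successors t μ, q ν ∈ Set.Icc (0 : ℝ) 1
  y'_mem : ∀ ν ∈ M.successors t μ, y' ν ∈ sigmaSet j (M.dualCone (t + 1) ν)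
  V_eq : M.Vfun ξ t μ x = M.Wfun ξ t μ x
  W_eq : M.Wfun ξ t μ x = ∑ ν ∈ M.successors t μ, (q ν : EReal) * M.Zfun ξ (t + 1) ν (y' ν)
  x_eq : x = ∑ ν ∈ M.successors t μ, q ν • y' ν
  sum_q : ∑ ν ∈ M.successors t μ, q ν = 1

/-- `(χ, Q, S)` is produced by the recursive procedure: for the nodewise data `y`, `l`, `x`, `s`, `q`
chosen by the initial choice, by the recursive steps at the times `t < T` and
by the terminal rule, `S` is the process `s`, `Q {ω}` is the product of the weights `q`
along the path of `ω`, and `χ_t = l_t (1 - ∑_{r<t} χ_r)`. -/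
def IsProcedureOutput (M : CurrencyModel Ω T d) (ξ : ℕ → Ω → Fin d → ℝ) (j : Fin d)
    (χ : ℕ → Ω → ℝ) (Q : Measure Ω) (S : ℕ → Ω → Fin d → ℝ) : Prop :=
  ∃ (y x s : ℕ → Set Ω → Fin d → ℝ) (l q : ℕ → Set Ω → ℝ),
    M.IsInitialChoice ξ j (y 0 Set.univ) ∧
    (∀ t < T, ∀ μ ∈ M.nodes t,
      M.IsStep ξ j t μ (y t μ) (l t μ) (x t μ) (s t μ) (q (t + 1)) (y (t + 1))) ∧
    (∀ μ ∈ M.nodes T, l T μ = 1 ∧ x T μ = y T μ ∧ s T μ = y T μ) ∧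
    (∀ t ≤ T, ∀ ω, S t ω = s t (M.node t ω)) ∧
    (∀ ω, Q {ω} = ENNReal.ofReal (∏ t ∈ Finset.Icc 1 T, q t (M.node t ω))) ∧
    (∀ t ≤ T, ∀ ω, χ t ω = l t (M.node t ω) * (1 - ∑ r ∈ Finset.range t, χ r ω))

end CurrencyModel

end

/-! The price is the least `x` for which `x e^j` lies in `𝓩_0`. A hedge starting outside `𝓩_0` fails
already against deterministic exercise dates: by non-anticipation, the hedge for exercise at `T`
agrees at time `t` with the one for exercise at `t`, which can deliver `ξ_t` and liquidate the rest
(`IsSellerHedge.mem_Zset`). Conversely, a portfolio in `𝓩_0` yields portfolios `w_t ∈ 𝓩_t` that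
hedge exercise at each single date up to deferred rebalancing. Mixing their liquidation strategies
with the fractions `χ_t` as weights hedges gradual exercise, because the solvency cones are convex
and stable under nonnegative known factors (`exists_isSellerHedge`).

All sets are polyhedral at each node: Fourier–Motzkin elimination makes projections, sums and
finitely generated cones polyhedral. A normal of a valid inequality for `𝓩_0` lies in `𝓠_0^*`, whose
nonzero elements have positive `j`-th coordinate. So the inequalities can be normalized, and those
for `x e^j` say `x ≥ -Z_0(s)`; compactness of `σ_j(𝓠_0^*)` gives the maximum
(`IsInitialChoice.askPrice_eq`).

Farkas' lemma splits a lower bound on an intersection of polyhedra into lower bounds on the members,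
so support functions of intersections are attained infimal convolutions. Applied to `𝓤 ∩ 𝓥` and to
the intersection over the successors that forms `𝓦`, this is the recursive step; the `j`-th
coordinates of the pieces become the weights `λ` and `q` (`exists_split_Zfun`, `exists_split_Wfun`).

Every output is verified by one backward induction, `IsGeneratedBy.nodeMean_tail`, used twice. For
the vectors `y`, `x`, `S` it identifies the conditional expectation of the tail of `S` as the
remaining fraction times `x_t`, an element of `𝓠_t^*`. For the numbers `-Z`, `-W`, `ξ·S` it
identifies `-Z_0(y_0)` as the expected payoff. -/

noncomputable section

/-! ### Polyhedra -/

/-- A finite intersection of closed half-spaces of a real vector space. -/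
def IsPolyhedral {E : Type*} [AddCommGroup E] [Module ℝ E] (A : Set E) : Prop :=
  ∃ s : Finset ((E →ₗ[ℝ] ℝ) × ℝ), A = {x | ∀ p ∈ s, p.2 ≤ p.1 x}

namespace IsPolyhedral

variable {E F : Type*} [AddCommGroup E] [Module ℝ E] [AddCommGroup F] [Module ℝ F]

theorem inter {A B : Set E} (hA : IsPolyhedral A) (hB : IsPolyhedral B) :
    IsPolyhedral (A ∩ B) := by
  classical
  obtain ⟨s, rfl⟩ := hA
  obtain ⟨t, rfl⟩ := hB
  refine ⟨s ∪ t, ?_⟩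
  ext x
  simp only [Set.mem_inter_iff, Set.mem_ofPred_eq, Finset.mem_union]
  exact ⟨fun h p hp => hp.elim (h.1 p) (h.2 p), fun h => ⟨fun p hp => h p (.inl hp),
    fun p hp => h p (.inr hp)⟩⟩

theorem univ : IsPolyhedral (Set.univ : Set E) := ⟨∅, by simp⟩

theorem halfSpace (f : E →ₗ[ℝ] ℝ) (b : ℝ) : IsPolyhedral {x | b ≤ f x} := ⟨{(f, b)}, by simp⟩

theorem biInter {ι : Type*} (F : Finset ι) {A : ι → Set E} (hA : ∀ i ∈ F, IsPolyhedral (A i)) :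
    IsPolyhedral (⋂ i ∈ F, A i) := by
  classical
  induction F using Finset.induction_on with
  | empty => simpa using univ
  | insert a F _ ih =>
    rw [Finset.set_biInter_insert]
    exact (hA a (by simp)).inter (ih fun i hi => hA i (by simp [hi]))

theorem iInter {ι : Type*} [Finite ι] {A : ι → Set E} (hA : ∀ i, IsPolyhedral (A i)) :
    IsPolyhedral (⋂ i, A i) := by
  cases nonempty_fintype ι
  simpa using biInter Finset.univ (fun i _ => hA i)

theorem preimage {A : Set E} (hA : IsPolyhedral A) (f : F →ₗ[ℝ] E) (c : E) :
    IsPolyhedral {x | f x + c ∈ A} := by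
  classical
  obtain ⟨s, rfl⟩ := hA
  refine ⟨s.image fun p => (p.1.comp f, p.2 - p.1 c), ?_⟩
  ext x
  simp only [Set.mem_ofPred_eq, Finset.forall_mem_image, LinearMap.comp_apply, map_add,
    sub_le_iff_le_add]

/-- **Fourier–Motzkin elimination** of one real variable. -/
theorem exists_real {A : Set (E × ℝ)} (hA : IsPolyhedral A) :
    IsPolyhedral {x : E | ∃ t : ℝ, (x, t) ∈ A} := by
  classical
  obtain ⟨s, rfl⟩ := hA
  set f : ((E × ℝ →ₗ[ℝ] ℝ) × ℝ) → (E →ₗ[ℝ] ℝ) := fun p => p.1.comp (LinearMap.inl ℝ E ℝ)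
  set c : ((E × ℝ →ₗ[ℝ] ℝ) × ℝ) → ℝ := fun p => p.1 (0, 1)
  have hp (p : (E × ℝ →ₗ[ℝ] ℝ) × ℝ) (x : E) (t : ℝ) : p.1 (x, t) = f p x + c p * t := by
    have : (x, t) = LinearMap.inl ℝ E ℝ x + t • ((0, 1) : E × ℝ) := by simp
    rw [this, map_add, map_smul]
    simp [f, c, mul_comm]
  have hs0 : IsPolyhedral (⋂ p ∈ s.filter (fun p => c p = 0), {x : E | p.2 ≤ f p x}) :=
    biInter _ fun p _ => halfSpace _ _
  have hs1 : IsPolyhedral (⋂ p ∈ s.filter (fun p => 0 < c p), ⋂ n ∈ s.filter (fun p => c p < 0),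
      {x : E | c p * n.2 - c n * p.2 ≤ (c p • f n - c n • f p) x}) :=
    biInter _ fun p _ => biInter _ fun n _ => halfSpace _ _
  convert hs0.inter hs1 using 1
  ext x
  simp only [Set.mem_ofPred_eq, Set.mem_inter_iff, Set.mem_iInter, Finset.mem_filter, and_imp, hp,
    LinearMap.sub_apply, LinearMap.smul_apply, smul_eq_mul]
  constructor
  · rintro ⟨t, ht⟩
    refine ⟨fun p hps h0 => by simpa [h0] using ht p hps, fun p hps hpc n hns hnc => ?_⟩
    -- The factors `c p` and `c n` make the terms in `t` cancel.
    have h1 := mul_le_mul_of_nonneg_left (ht n hns) hpc.le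
    have h2 := mul_le_mul_of_nonpos_left (ht p hps) hnc.le
    linarith
  · rintro ⟨h0, h1⟩
    -- Every lower bound for `t` lies below every upper bound, so the largest lower bound serves.
    -- Without lower bounds the least upper bound does, and `0` if there are no bounds at all.
    have key : ∃ t : ℝ, (∀ p ∈ s.filter (fun p => 0 < c p), (p.2 - f p x) / c p ≤ t) ∧
        ∀ n ∈ s.filter (fun p => c p < 0), t ≤ (n.2 - f n x) / c n := by
      have hle : ∀ p ∈ s.filter (fun p => 0 < c p), ∀ n ∈ s.filter (fun p => c p < 0),
          (p.2 - f p x) / c p ≤ (n.2 - f n x) / c n := by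
        intro p hps n hns
        rw [Finset.mem_filter] at hps hns
        have := h1 p hps.1 hps.2 n hns.1 hns.2
        rw [div_le_iff₀ hps.2, div_mul_eq_mul_div, le_div_iff_of_neg hns.2]
        linarith
      rcases (s.filter (fun p => 0 < c p)).eq_empty_or_nonempty with h | h
      · rcases (s.filter (fun p => c p < 0)).eq_empty_or_nonempty with h' | h'
        · exact ⟨0, by simp [h], by simp [h']⟩
        · exact ⟨(s.filter (fun p => c p < 0)).inf' h' fun n => (n.2 - f n x) / c n, by simp [h],
            fun n hn => Finset.inf'_le (fun n => (n.2 - f n x) / c n) hn⟩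
      · exact ⟨(s.filter (fun p => 0 < c p)).sup' h fun p => (p.2 - f p x) / c p,
          fun p hp => Finset.le_sup' (fun p => (p.2 - f p x) / c p) hp,
          fun n hn => Finset.sup'_le _ _ fun p hp => hle p hp n hn⟩
    obtain ⟨t, ht1, ht2⟩ := key
    refine ⟨t, fun p hps => ?_⟩
    rcases lt_trichotomy (c p) 0 with h | h | h
    · have := ht2 p (Finset.mem_filter.2 ⟨hps, h⟩)
      rw [le_div_iff_of_neg h] at this
      linarith
    · simpa [h] using h0 p hps h
    · have := ht1 p (Finset.mem_filter.2 ⟨hps, h⟩)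
      rw [div_le_iff₀ h] at this
      linarith

theorem exists_fin {n : ℕ} : ∀ {E : Type _} [AddCommGroup E] [Module ℝ E]
    {A : Set (E × (Fin n → ℝ))}, IsPolyhedral A → IsPolyhedral {x : E | ∃ u, (x, u) ∈ A} := by
  induction n with
  | zero =>
    intro E _ _ A hA
    convert hA.preimage (LinearMap.inl ℝ E (Fin 0 → ℝ)) 0 using 1
    ext x
    simp only [Set.mem_ofPred_eq, add_zero, LinearMap.inl_apply]
    exact ⟨fun ⟨u, hu⟩ => by rwa [Subsingleton.elim 0 u], fun h => ⟨0, h⟩⟩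
  | succ n ih =>
    intro E _ _ A hA
    let g : ((E × (Fin n → ℝ)) × ℝ) →ₗ[ℝ] E × (Fin (n + 1) → ℝ) :=
      { toFun := fun p => (p.1.1, Fin.cons p.2 p.1.2)
        map_add' := fun p q => by
          ext i
          · rfl
          · refine Fin.cases ?_ (fun i => ?_) i <;> simp
        map_smul' := fun r p => by
          ext i
          · rfl
          · refine Fin.cases ?_ (fun i => ?_) i <;> simp }
    convert ih (exists_real (hA.preimage g 0)) using 1
    ext x
    simp only [Set.mem_ofPred_eq, add_zero, g, LinearMap.coe_mk, AddHom.coe_mk]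
    constructor
    · rintro ⟨u, hu⟩
      exact ⟨Fin.tail u, u 0, by rwa [Fin.cons_self_tail]⟩
    · rintro ⟨u, t, h⟩
      exact ⟨_, h⟩

/-- Projections of polyhedra along finite dimensional spaces are polyhedra. -/
theorem exists_proj [FiniteDimensional ℝ F] {A : Set (E × F)} (hA : IsPolyhedral A) :
    IsPolyhedral {x : E | ∃ u, (x, u) ∈ A} := by
  let e := (Module.finBasis ℝ F).equivFun
  convert exists_fin (hA.preimage (LinearMap.id.prodMap e.symm.toLinearMap) 0) using 1
  ext x
  simp only [Set.mem_ofPred_eq, add_zero, LinearMap.prodMap_apply, LinearMap.id_apply]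
  exact ⟨fun ⟨u, hu⟩ => ⟨e u, by simpa using hu⟩, fun ⟨u, hu⟩ => ⟨_, hu⟩⟩

/-- The sum is the projection of the pairs `(x, a)` with `a ∈ A` and `x - a ∈ B`. -/
theorem add [FiniteDimensional ℝ E] {A B : Set E} (hA : IsPolyhedral A) (hB : IsPolyhedral B) :
    IsPolyhedral (A + B) := by
  convert exists_proj ((hA.preimage (LinearMap.snd ℝ E E) 0).inter
    (hB.preimage (LinearMap.fst ℝ E E - LinearMap.snd ℝ E E) 0)) using 1
  ext x
  simp only [Set.mem_add, Set.mem_inter_iff, Set.mem_ofPred_eq, add_zero, LinearMap.snd_apply,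
    LinearMap.sub_apply, LinearMap.fst_apply]
  exact ⟨fun ⟨a, ha, b, hb, h⟩ => ⟨a, ha, by rwa [← h, add_sub_cancel_left]⟩,
    fun ⟨a, ha, hb⟩ => ⟨a, ha, x - a, hb, by simp⟩⟩

theorem hyperplane (f : E →ₗ[ℝ] ℝ) (b : ℝ) : IsPolyhedral {x | f x = b} := by
  convert (halfSpace f b).inter (halfSpace (-f) (-b)) using 1
  ext x
  simp [le_antisymm_iff, and_comm]

theorem singleton [FiniteDimensional ℝ E] (a : E) : IsPolyhedral {a} := by
  convert iInter (fun i => hyperplane ((Module.finBasis ℝ E).coord i)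
    ((Module.finBasis ℝ E).coord i a)) using 1
  ext x
  simp only [Set.mem_singleton_iff, Set.mem_iInter, Set.mem_ofPred_eq]
  exact ⟨fun h i => by rw [h], fun h => (Module.finBasis ℝ E).ext_elem h⟩

/-- Finitely generated cones are polyhedral. -/
theorem hull [FiniteDimensional ℝ E] (s : Finset E) :
    IsPolyhedral (PointedCone.hull ℝ (s : Set E) : Set E) := by
  classical
  induction s using Finset.induction_on with
  | empty => simpa [PointedCone.hull] using singleton (0 : E)
  | insert g s _ ih =>
    -- A point `x` is in the larger cone iff `x - t • g` is in the smaller one for some `t ≥ 0`; the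
    -- variable `t` is then eliminated.
    let f : E × ℝ →ₗ[ℝ] E := LinearMap.fst ℝ E ℝ - (LinearMap.snd ℝ E ℝ).smulRight g
    convert exists_real ((ih.preimage f 0).inter (halfSpace (LinearMap.snd ℝ E ℝ) 0)) using 1
    ext x
    simp only [PointedCone.hull, Finset.coe_insert, SetLike.mem_coe, Submodule.mem_span_insert,
      Set.mem_ofPred_eq, Set.mem_inter_iff, add_zero, LinearMap.snd_apply, f, LinearMap.sub_apply,
      LinearMap.fst_apply, LinearMap.smulRight_apply]
    constructor
    · rintro ⟨a, z, hz, rfl⟩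
      exact ⟨a.1, by simpa [Nonneg.mk_smul] using hz, a.2⟩
    · rintro ⟨t, ht, h0⟩
      exact ⟨⟨t, h0⟩, _, ht, by simp [Nonneg.mk_smul]⟩

end IsPolyhedral

/-! ### Farkas' lemma and the splitting of lower bounds -/

theorem IsPolyhedral.exists_vectors {d : ℕ} {A : Set (Fin d → ℝ)} (hA : IsPolyhedral A) :
    ∃ s : Finset ((Fin d → ℝ) × ℝ), A = {x | ∀ p ∈ s, p.2 ≤ p.1 ⬝ᵥ x} := by
  classical
  obtain ⟨s, rfl⟩ := hA
  refine ⟨s.image fun p => (fun i => p.1 (Pi.single i 1), p.2), ?_⟩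
  ext x
  simp only [Set.mem_ofPred_eq, Finset.forall_mem_image]
  refine forall₂_congr fun p _ => ?_
  rw [LinearMap.pi_apply_eq_sum_univ p.1 x]
  simp only [dotProduct, smul_eq_mul, mul_comm]
  congr!
  simp [Pi.single_apply, eq_comm]

/-- **Farkas' lemma** for finitely generated cones. -/
theorem exists_linear_of_notMem_hull {E : Type*} [AddCommGroup E] [Module ℝ E]
    [FiniteDimensional ℝ E] {s : Finset E} {z : E} (hz : z ∉ PointedCone.hull ℝ (s : Set E)) :
    ∃ f : E →ₗ[ℝ] ℝ, f z < 0 ∧ ∀ g ∈ s, 0 ≤ f g := by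
  obtain ⟨t, ht⟩ := IsPolyhedral.hull s
  have hz' : z ∉ {x | ∀ p ∈ t, p.2 ≤ p.1 x} := ht ▸ hz
  simp only [Set.mem_ofPred_eq, not_forall, not_le] at hz'
  obtain ⟨p, hp, hpz⟩ := hz'
  have hmem (x : E) (hx : x ∈ PointedCone.hull ℝ (s : Set E)) : p.2 ≤ p.1 x := by
    have : x ∈ {x | ∀ p ∈ t, p.2 ≤ p.1 x} := ht ▸ hx
    exact this p hp
  have h0 : p.2 ≤ 0 := by simpa using hmem 0 (zero_mem _)
  refine ⟨p.1, hpz.trans_le h0, fun g hg => ?_⟩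
  have hg' : g ∈ PointedCone.hull ℝ (s : Set E) := Submodule.subset_span hg
  by_contra! hneg
  -- This multiple of `g` stays in the cone although `p.1` takes the value `p.2 - 1` there.
  have := hmem ((⟨(p.2 - 1) / p.1 g, div_nonneg_of_nonpos (by linarith) hneg.le⟩ :
    {c : ℝ // 0 ≤ c}) • g) (Submodule.smul_mem _ _ hg')
  rw [Nonneg.mk_smul, map_smul, smul_eq_mul, div_mul_cancel₀ _ hneg.ne] at this
  linarith

/-- The affine form of **Farkas' lemma**. -/
theorem mem_hull_of_forall_le {d : ℕ} {s : Finset ((Fin d → ℝ) × ℝ)} {y : Fin d → ℝ} {γ : ℝ}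
    (hne : {x | ∀ p ∈ s, p.2 ≤ p.1 ⬝ᵥ x}.Nonempty)
    (h : ∀ x ∈ {x | ∀ p ∈ s, p.2 ≤ p.1 ⬝ᵥ x}, γ ≤ y ⬝ᵥ x) :
    (y, γ) ∈ PointedCone.hull ℝ (insert (0, -1) (s : Set ((Fin d → ℝ) × ℝ))) := by
  classical
  by_contra hy
  rw [← Finset.coe_insert] at hy
  obtain ⟨f, hf, hfs⟩ := exists_linear_of_notMem_hull hy
  set x : Fin d → ℝ := fun i => f (Pi.single i 1, 0)
  set t : ℝ := f (0, 1)
  have hfx (v : Fin d → ℝ) (b : ℝ) : f (v, b) = v ⬝ᵥ x + b * t := by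
    have h1 : (v, b) = LinearMap.inl ℝ _ ℝ v + b • ((0 : Fin d → ℝ), (1 : ℝ)) := by simp
    rw [h1, map_add, map_smul, ← LinearMap.comp_apply, LinearMap.pi_apply_eq_sum_univ]
    simp only [dotProduct, x, t, smul_eq_mul, LinearMap.comp_apply, LinearMap.inl_apply]
    congr 1
    refine Finset.sum_congr rfl fun i _ => ?_
    congr 3
    ext k
    simp [Pi.single_apply, eq_comm]
  obtain ⟨a, ha⟩ := hne
  have ht : t ≤ 0 := by
    have := hfs (0, -1) (by simp)
    rw [hfx] at this
    simpa using this
  rw [hfx] at hf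
  have hxs : ∀ p ∈ s, 0 ≤ p.1 ⬝ᵥ x + p.2 * t := fun p hp => by
    rw [← hfx]
    exact hfs p (by simp [hp])
  -- The separating functional is `(v, b) ↦ v ⬝ᵥ x + b * t`. If `t < 0`, rescaling `x` gives a point
  -- of the polyhedron that violates the bound. If `t = 0`, then `x` is a recession direction along
  -- which `y` decreases, and the multiple below leads from `a` to the value `γ - 1`.
  rcases ht.lt_or_eq with ht | ht
  · have := h ((-t)⁻¹ • x) fun p hp => by
      rw [dotProduct_smul, smul_eq_mul, ← div_eq_inv_mul, le_div_iff₀ (by linarith)]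
      linarith [hxs p hp]
    rw [dotProduct_smul, smul_eq_mul, ← div_eq_inv_mul, le_div_iff₀ (by linarith)] at this
    linarith
  · rw [ht, mul_zero, add_zero] at hf
    have hc : 0 ≤ (γ - y ⬝ᵥ a - 1) / (y ⬝ᵥ x) := by
      refine div_nonneg_of_nonpos ?_ hf.le
      linarith [h a ha]
    have := h (a + ((γ - y ⬝ᵥ a - 1) / (y ⬝ᵥ x)) • x) fun p hp => by
      have h1 := hxs p hp
      rw [ht, mul_zero, add_zero] at h1
      rw [dotProduct_add, dotProduct_smul, smul_eq_mul]
      have := ha p hp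
      nlinarith [mul_nonneg hc h1]
    rw [dotProduct_add, dotProduct_smul, smul_eq_mul, div_mul_cancel₀ _ hf.ne] at this
    linarith

/-- The easy half of Farkas' lemma: the inequalities valid at a given point form a cone, which
contains the trivial one `-1 ≤ 0`. -/
theorem le_dotProduct_of_mem_hull {d : ℕ} {s : Set ((Fin d → ℝ) × ℝ)} {z : (Fin d → ℝ) × ℝ}
    (hz : z ∈ PointedCone.hull ℝ (insert (0, -1) s)) {x : Fin d → ℝ}
    (hx : ∀ p ∈ s, p.2 ≤ p.1 ⬝ᵥ x) : z.2 ≤ z.1 ⬝ᵥ x := by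
  induction hz using Submodule.span_induction with
  | mem z hz =>
    rcases hz with rfl | hz
    · simp
    · exact hx z hz
  | zero => simp
  | add a b _ _ ha hb => simpa [add_dotProduct] using add_le_add ha hb
  | smul c z _ hz =>
    obtain ⟨c, hc⟩ := c
    simpa [Nonneg.mk_smul, smul_dotProduct] using mul_le_mul_of_nonneg_left hz hc

/-- A lower bound of a linear functional on the intersection of two polyhedra splits. -/
theorem IsPolyhedral.exists_split {d : ℕ} {A B : Set (Fin d → ℝ)} (hA : IsPolyhedral A)
    (hB : IsPolyhedral B) (hne : (A ∩ B).Nonempty) {y : Fin d → ℝ} {γ : ℝ}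
    (h : ∀ x ∈ A ∩ B, γ ≤ y ⬝ᵥ x) :
    ∃ y₁ y₂ γ₁ γ₂, y = y₁ + y₂ ∧ γ = γ₁ + γ₂ ∧ (∀ x ∈ A, γ₁ ≤ y₁ ⬝ᵥ x) ∧
      ∀ x ∈ B, γ₂ ≤ y₂ ⬝ᵥ x := by
  classical
  obtain ⟨s, rfl⟩ := hA.exists_vectors
  obtain ⟨t, rfl⟩ := hB.exists_vectors
  have hst : {x | ∀ p ∈ s, p.2 ≤ p.1 ⬝ᵥ x} ∩ {x | ∀ p ∈ t, p.2 ≤ p.1 ⬝ᵥ x} =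
      {x : Fin d → ℝ | ∀ p ∈ s ∪ t, p.2 ≤ p.1 ⬝ᵥ x} := by
    ext x
    simp only [Set.mem_inter_iff, Set.mem_ofPred_eq, Finset.mem_union]
    exact ⟨fun h p hp => hp.elim (h.1 p) (h.2 p), fun h => ⟨fun p hp => h p (.inl hp),
      fun p hp => h p (.inr hp)⟩⟩
  rw [hst] at h hne
  have := mem_hull_of_forall_le hne h
  -- The cone generated by a union is the sum of the two cones, so the Farkas certificate splits;
  -- the trivial inequality is given to both parts.
  rw [Finset.coe_union, Set.insert_union_distrib, PointedCone.hull, Submodule.span_union,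
    Submodule.mem_sup] at this
  obtain ⟨a, ha, b, hb, hab⟩ := this
  exact ⟨a.1, b.1, a.2, b.2, (congrArg Prod.fst hab).symm, (congrArg Prod.snd hab).symm,
    fun x hx => le_dotProduct_of_mem_hull ha hx, fun x hx => le_dotProduct_of_mem_hull hb hx⟩

/-- A lower bound of a linear functional on a finite intersection of polyhedra splits. -/
theorem IsPolyhedral.exists_split_biInter {d : ℕ} {ι : Type*} {F : Finset ι} (hF : F.Nonempty)
    {A : ι → Set (Fin d → ℝ)} (hA : ∀ i ∈ F, IsPolyhedral (A i))
    (hne : (⋂ i ∈ F, A i).Nonempty) {y : Fin d → ℝ} {γ : ℝ}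
    (h : ∀ x ∈ ⋂ i ∈ F, A i, γ ≤ y ⬝ᵥ x) :
    ∃ (w : ι → Fin d → ℝ) (c : ι → ℝ), y = ∑ i ∈ F, w i ∧ γ = ∑ i ∈ F, c i ∧
      ∀ i ∈ F, ∀ x ∈ A i, c i ≤ w i ⬝ᵥ x := by
  classical
  induction hF using Finset.Nonempty.cons_induction generalizing y γ with
  | singleton a =>
    refine ⟨fun _ => y, fun _ => γ, by simp, by simp, ?_⟩
    simpa using h
  | cons a F ha hF ih =>
    simp only [Finset.cons_eq_insert, Finset.set_biInter_insert] at h hne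
    obtain ⟨y₁, y₂, γ₁, γ₂, rfl, rfl, h₁, h₂⟩ :=
      (hA a (by simp)).exists_split (biInter F fun i hi => hA i (by simp [hi])) hne h
    obtain ⟨w, c, rfl, rfl, h₃⟩ := ih (fun i hi => hA i (by simp [hi]))
      (hne.mono Set.inter_subset_right) h₂
    have hane (i : ι) (hi : i ∈ F) : i ≠ a := fun h => ha (h ▸ hi)
    refine ⟨Function.update w a y₁, Function.update c a γ₁, ?_, ?_, fun i hi => ?_⟩
    · rw [Finset.sum_cons, Function.update_self]
      exact congrArg _ (Finset.sum_congr rfl fun i hi => by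
        rw [Function.update_of_ne (hane i hi)])
    · rw [Finset.sum_cons, Function.update_self]
      exact congrArg _ (Finset.sum_congr rfl fun i hi => by
        rw [Function.update_of_ne (hane i hi)])
    · rcases Finset.mem_cons.1 hi with rfl | hi
      · simpa using h₁
      · simpa [Function.update_of_ne (hane i hi)] using h₃ i hi

/-! ### Support functions of reflected sets -/

section Support

variable {d : ℕ} {A B C : Set (Fin d → ℝ)} {y : Fin d → ℝ}

/-- Up to sign, the support function of `-A` is the infimum of `y` over `A`; estimates with real
bounds are moved through this form. -/
theorem supportFun_neg_le_iff {c : ℝ} :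
    supportFun (-A) y ≤ c ↔ ∀ a ∈ A, -c ≤ y ⬝ᵥ a := by
  simp only [supportFun, iSup_le_iff, EReal.coe_le_coe_iff]
  constructor
  · intro h a ha
    have := h (-a) (by simpa using ha)
    rw [dotProduct_neg] at this
    linarith
  · intro h a ha
    have := h (-a) ha
    rw [dotProduct_neg] at this
    linarith

theorem neg_dotProduct_le_supportFun {a : Fin d → ℝ} (ha : a ∈ A) :
    ((-(y ⬝ᵥ a) : ℝ) : EReal) ≤ supportFun (-A) y := by
  rw [← dotProduct_neg]
  exact le_iSup₂_of_le (-a) (by simpa using ha) le_rfl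

/-- Nonemptiness excludes the value `⊥`. -/
theorem exists_supportFun_eq_coe (hA : A.Nonempty) (h : supportFun (-A) y < ⊤) :
    ∃ c : ℝ, supportFun (-A) y = c := by
  obtain ⟨a, ha⟩ := hA
  have := neg_dotProduct_le_supportFun (y := y) ha
  exact ⟨_, (EReal.coe_toReal h.ne fun h' => by simp [h'] at this).symm⟩

theorem supportFun_neg_lt_top_of_le {c : ℝ} (h : ∀ a ∈ A, c ≤ y ⬝ᵥ a) :
    supportFun (-A) y < ⊤ :=
  (supportFun_neg_le_iff (c := -c) |>.2 (by simpa using h)).trans_lt (EReal.coe_lt_top _)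

/-- Homogeneity at finite values. For `r = 0` it needs a point of `A`, since the supremum over the
empty set is `⊥` and not `0`. -/
theorem supportFun_neg_smul {c : ℝ} {r : ℝ} (hr : 0 ≤ r) (hA : A.Nonempty)
    (h : supportFun (-A) y = c) : supportFun (-A) (r • y) = ((r * c : ℝ) : EReal) := by
  have h1 := supportFun_neg_le_iff.1 h.le
  refine le_antisymm (supportFun_neg_le_iff.2 fun a ha => ?_) ?_
  · rw [smul_dotProduct, smul_eq_mul]
    nlinarith [mul_le_mul_of_nonneg_left (h1 a ha) hr]
  · have hfin : supportFun (-A) (r • y) < ⊤ := supportFun_neg_lt_top_of_le (c := r * -c)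
      fun a ha => by
        rw [smul_dotProduct, smul_eq_mul]
        exact mul_le_mul_of_nonneg_left (h1 a ha) hr
    obtain ⟨b, hb⟩ := exists_supportFun_eq_coe hA hfin
    rw [hb, EReal.coe_le_coe_iff]
    have h2 := supportFun_neg_le_iff.1 hb.le
    rcases hr.eq_or_lt with rfl | hr
    · obtain ⟨a, ha⟩ := hA
      simpa using h2 a ha
    · have h3 : supportFun (-A) y ≤ ((b / r : ℝ) : EReal) := supportFun_neg_le_iff.2 fun a ha => by
        have := h2 a ha
        rw [smul_dotProduct, smul_eq_mul] at this
        rw [← neg_div, div_le_iff₀ hr]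
        linarith
      rw [h, EReal.coe_le_coe_iff, le_div_iff₀ hr] at h3
      linarith

theorem supportFun_neg_mono (h : A ⊆ B) : supportFun (-A) y ≤ supportFun (-B) y :=
  biSup_mono fun _ ha => h ha

/-- If `A` is stable under adding elements of a cone, then the domain of its support function is
contained in the dual cone. -/
theorem mem_polarNeg_of_supportFun_lt_top (hA : A.Nonempty)
    (hAC : ∀ a ∈ A, ∀ c ∈ C, a + c ∈ A) (hC : ∀ r : ℝ, 0 ≤ r → ∀ c ∈ C, r • c ∈ C)
    (h : supportFun (-A) y < ⊤) : y ∈ polarNeg C := by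
  obtain ⟨b, hb⟩ := exists_supportFun_eq_coe hA h
  obtain ⟨a, ha⟩ := hA
  have h1 := supportFun_neg_le_iff.1 hb.le
  intro x hx
  by_contra! hneg
  -- Moving from `a` by this multiple of `x` brings `y` down to `-b - 1`, below its lower bound `-b`
  -- on `A`.
  have h0 : 0 ≤ (-b - y ⬝ᵥ a - 1) / (y ⬝ᵥ x) :=
    div_nonneg_of_nonpos (by linarith [h1 a ha]) hneg.le
  have := h1 _ (hAC a ha _ (hC _ h0 x hx))
  rw [dotProduct_add, dotProduct_smul, smul_eq_mul, div_mul_cancel₀ _ hneg.ne] at this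
  linarith

/-- For `y` in the dual cone the minimum over `C` is attained at `0`, so adding `C` does not change
the infimum over `A`. -/
theorem supportFun_neg_add_cone (h0 : 0 ∈ C) (hy : y ∈ polarNeg C) :
    supportFun (-(A + C)) y = supportFun (-A) y := by
  refine le_antisymm ?_ (supportFun_neg_mono fun a ha => ⟨a, ha, 0, h0, by simp⟩)
  refine iSup₂_le fun z hz => ?_
  obtain ⟨a, ha, c, hc, h⟩ := hz
  refine le_trans ?_ (neg_dotProduct_le_supportFun ha)
  have hac : z = -(a + c) := by
    change a + c = -z at h
    rw [h, neg_neg]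
  rw [EReal.coe_le_coe_iff, hac, dotProduct_neg, dotProduct_add]
  linarith [hy c hc]

theorem supportFun_neg_singleton (a : Fin d → ℝ) :
    supportFun (-{a}) y = ((-(y ⬝ᵥ a) : ℝ) : EReal) := by
  refine le_antisymm (supportFun_neg_le_iff.2 ?_) (neg_dotProduct_le_supportFun rfl)
  simp

/-- Any decomposition of `y` bounds the value on the intersection by the sum of the two values; the
Farkas splitting gives the reverse inequality for one of them. Polyhedrality is what makes the
infimal convolution attained. -/
theorem exists_supportFun_inter (hA : IsPolyhedral A) (hB : IsPolyhedral B)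
    (hne : (A ∩ B).Nonempty) {c : ℝ} (h : supportFun (-(A ∩ B)) y = c) :
    ∃ y₁ y₂, ∃ c₁ c₂ : ℝ, y = y₁ + y₂ ∧ c = c₁ + c₂ ∧ supportFun (-A) y₁ = c₁ ∧
      supportFun (-B) y₂ = c₂ := by
  obtain ⟨y₁, y₂, γ₁, γ₂, rfl, hγ, h₁, h₂⟩ :=
    hA.exists_split hB hne (supportFun_neg_le_iff.1 h.le)
  obtain ⟨c₁, hc₁⟩ := exists_supportFun_eq_coe (hne.mono Set.inter_subset_left)
    (supportFun_neg_lt_top_of_le h₁)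
  obtain ⟨c₂, hc₂⟩ := exists_supportFun_eq_coe (hne.mono Set.inter_subset_right)
    (supportFun_neg_lt_top_of_le h₂)
  refine ⟨y₁, y₂, c₁, c₂, rfl, le_antisymm ?_ ?_, hc₁, hc₂⟩
  · rw [← EReal.coe_le_coe_iff, ← h]
    refine supportFun_neg_le_iff.2 fun a ha => ?_
    rw [add_dotProduct]
    linarith [supportFun_neg_le_iff.1 hc₁.le a ha.1, supportFun_neg_le_iff.1 hc₂.le a ha.2]
  · have e₁ : (c₁ : EReal) ≤ (-γ₁ : ℝ) := hc₁ ▸ supportFun_neg_le_iff.2 (by simpa using h₁)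
    have e₂ : (c₂ : EReal) ≤ (-γ₂ : ℝ) := hc₂ ▸ supportFun_neg_le_iff.2 (by simpa using h₂)
    rw [EReal.coe_le_coe_iff] at e₁ e₂
    linarith

theorem exists_supportFun_biInter {ι : Type*} {F : Finset ι} (hF : F.Nonempty)
    {A : ι → Set (Fin d → ℝ)} (hA : ∀ i ∈ F, IsPolyhedral (A i))
    (hne : (⋂ i ∈ F, A i).Nonempty) {b : ℝ} (h : supportFun (-(⋂ i ∈ F, A i)) y = b) :
    ∃ (w : ι → Fin d → ℝ) (c : ι → ℝ), y = ∑ i ∈ F, w i ∧ b = ∑ i ∈ F, c i ∧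
      ∀ i ∈ F, supportFun (-A i) (w i) = c i := by
  obtain ⟨w, γ, rfl, hγ, h₁⟩ :=
    IsPolyhedral.exists_split_biInter hF hA hne (supportFun_neg_le_iff.1 h.le)
  have hsub (i : ι) (hi : i ∈ F) : (⋂ i ∈ F, A i) ⊆ A i := Set.biInter_subset_of_mem hi
  have key (i : ι) (hi : i ∈ F) : ∃ c : ℝ, supportFun (-A i) (w i) = c :=
    exists_supportFun_eq_coe (hne.mono (hsub i hi)) (supportFun_neg_lt_top_of_le (h₁ i hi))
  choose! c hc using key
  refine ⟨w, c, rfl, le_antisymm ?_ ?_, hc⟩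
  · rw [← EReal.coe_le_coe_iff, ← h]
    refine supportFun_neg_le_iff.2 fun a ha => ?_
    rw [sum_dotProduct, ← Finset.sum_neg_distrib]
    exact Finset.sum_le_sum fun i hi => supportFun_neg_le_iff.1 (hc i hi).le a (hsub i hi ha)
  · rw [← neg_neg b, hγ, ← Finset.sum_neg_distrib]
    refine Finset.sum_le_sum fun i hi => ?_
    rw [← EReal.coe_le_coe_iff, ← hc i hi]
    exact supportFun_neg_le_iff.2 (by simpa using h₁ i hi)

/-- A polyhedral cone that does not contain `-e_j`
has a dual vector with `j`-th coordinate `1`. -/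
theorem IsPolyhedral.sigmaSet_polarNeg_nonempty (hC : IsPolyhedral C) (j : Fin d)
    (hsmul : ∀ r : ℝ, 0 ≤ r → ∀ c ∈ C, r • c ∈ C) (hne : C.Nonempty)
    (hj : Pi.single j (-1) ∉ C) : (sigmaSet j (polarNeg C)).Nonempty := by
  obtain ⟨s, rfl⟩ := hC.exists_vectors
  simp only [Set.mem_ofPred_eq, not_forall, not_le] at hj
  obtain ⟨p, hp, hpj⟩ := hj
  have h0 : p.2 ≤ 0 := by
    obtain ⟨c, hc⟩ := hne
    simpa using hsmul 0 le_rfl c hc p hp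
  have hpol : p.1 ∈ polarNeg {x | ∀ p ∈ s, p.2 ≤ p.1 ⬝ᵥ x} := by
    intro x hx
    by_contra! hneg
    have := hsmul ((p.2 - 1) / (p.1 ⬝ᵥ x)) (div_nonneg_of_nonpos (by linarith) hneg.le) x hx p hp
    rw [dotProduct_smul, smul_eq_mul, div_mul_cancel₀ _ hneg.ne] at this
    linarith
  rw [dotProduct_single] at hpj
  have hpos : 0 < p.1 j := by linarith
  refine ⟨(p.1 j)⁻¹ • p.1, fun x hx => ?_, ?_⟩
  · rw [smul_dotProduct]
    exact smul_nonneg (by positivity) (hpol x hx)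
  · simp [hpos.ne']

end Support

theorem nodeSection_mono {Ω : Type*} {d : ℕ} {A B : Set (Ω → Fin d → ℝ)} (h : A ⊆ B) (μ : Set Ω) :
    nodeSection A μ ⊆ nodeSection B μ :=
  fun _ ⟨z, hz, hv⟩ => ⟨z, h hz, hv⟩

namespace CurrencyModel

variable {Ω : Type*} [Finite Ω] [MeasurableSpace Ω] {T d : ℕ} (M : CurrencyModel Ω T d)

/-! ### Nodes -/

section Nodes

variable {M} {s t : ℕ} {ω ω' : Ω}

theorem mem_node_self (M : CurrencyModel Ω T d) (t : ℕ) (ω : Ω) : ω ∈ M.node t ω :=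
  @mem_measurableAtom_self _ (M.filt t) ω

theorem node_eq_of_mem (h : ω' ∈ M.node t ω) : M.node t ω' = M.node t ω :=
  @measurableAtom_eq_of_mem _ (M.filt t) _ _ h

theorem mem_node_iff : ω' ∈ M.node t ω ↔ M.node t ω' = M.node t ω :=
  ⟨node_eq_of_mem, fun h => h ▸ M.mem_node_self t ω'⟩

theorem measurableSet_node (M : CurrencyModel Ω T d) (t : ℕ) (ω : Ω) :
    MeasurableSet[M.filt t] (M.node t ω) :=
  @MeasurableSet.measurableAtom_of_countable _ (M.filt t) _ ω

theorem node_anti (M : CurrencyModel Ω T d) (h : s ≤ t) (ω : Ω) : M.node t ω ⊆ M.node s ω :=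
  @measurableAtom_subset _ (M.filt t) _ _ (M.filt.mono h _ (M.measurableSet_node s ω))
    (M.mem_node_self s ω)

theorem node_eq_of_le (hst : s ≤ t) (h : M.node t ω' = M.node t ω) :
    M.node s ω' = M.node s ω :=
  node_eq_of_mem (M.node_anti hst ω (mem_node_iff.2 h))

theorem node_zero (M : CurrencyModel Ω T d) (ω : Ω) : M.node 0 ω = Set.univ := by
  have h := M.measurableSet_node 0 ω
  rw [M.filt_zero, MeasurableSpace.measurableSet_bot_iff] at h
  exact h.resolve_left (Set.nonempty_iff_ne_empty.1 ⟨ω, M.mem_node_self 0 ω⟩)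

theorem node_final (M : CurrencyModel Ω T d) (ω : Ω) : M.node T ω = {ω} := by
  have h : MeasurableSet[M.filt T] {ω} := by
    rw [M.filt_final]
    trivial
  exact Set.Subset.antisymm (@measurableAtom_subset _ (M.filt T) _ _ h rfl)
    (Set.singleton_subset_iff.2 (M.mem_node_self T ω))

theorem eq_of_node_eq {α : Type*} [MeasurableSpace α] [MeasurableSingletonClass α] {f : Ω → α}
    (hf : Measurable[M.filt t] f) (h : M.node t ω' = M.node t ω) : f ω' = f ω :=
  @mem_of_mem_measurableAtom _ (M.filt t) _ _ (mem_node_iff.2 h) _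
    (hf (measurableSet_singleton (f ω))) rfl

theorem measurable_of_node_eq {α : Type*} [MeasurableSpace α] {f : Ω → α}
    (h : ∀ ω ω', M.node t ω' = M.node t ω → f ω' = f ω) : Measurable[M.filt t] f := by
  intro s _
  have : f ⁻¹' s = ⋃ ω ∈ f ⁻¹' s, M.node t ω := by
    ext ω
    simp only [Set.mem_preimage, Set.mem_iUnion, exists_prop]
    exact ⟨fun hω => ⟨ω, hω, M.mem_node_self t ω⟩,
      fun ⟨ω', h', hω⟩ => (h _ _ (node_eq_of_mem hω)).symm ▸ h'⟩
  rw [this]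
  exact MeasurableSet.biUnion (Set.to_countable _) fun ω _ => M.measurableSet_node t ω

/-- On a finite space the nodes are measurable, so measurability is constancy on nodes; this turns
questions about `𝓕_t` into nodewise ones. -/
theorem measurable_iff_node {α : Type*} [MeasurableSpace α] [MeasurableSingletonClass α]
    {f : Ω → α} :
    Measurable[M.filt t] f ↔ ∀ ω ω', M.node t ω' = M.node t ω → f ω' = f ω :=
  ⟨fun h _ _ h' => eq_of_node_eq h h', measurable_of_node_eq⟩

theorem measurable_node_comp {α : Type*} [MeasurableSpace α] (M : CurrencyModel Ω T d) (t : ℕ)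
    (g : Set Ω → α) : Measurable[M.filt t] fun ω => g (M.node t ω) :=
  measurable_of_node_eq fun ω ω' h => by rw [h]

theorem mem_successors {μ ν : Set Ω} :
    ν ∈ M.successors t μ ↔ ν ∈ M.nodes (t + 1) ∧ ν ⊆ μ := by
  simp [successors]

theorem node_succ_mem_successors_iff :
    M.node (t + 1) ω' ∈ M.successors t (M.node t ω) ↔ M.node t ω' = M.node t ω := by
  rw [mem_successors]
  refine ⟨fun h => node_eq_of_mem (h.2 (M.mem_node_self _ _)), fun h => ⟨⟨ω', rfl⟩, ?_⟩⟩
  rw [← h]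
  exact M.node_anti t.le_succ ω'

theorem successors_nonempty (M : CurrencyModel Ω T d) (t : ℕ) (ω : Ω) :
    (M.successors t (M.node t ω)).Nonempty :=
  ⟨_, node_succ_mem_successors_iff.2 rfl⟩

theorem exists_of_mem_successors {ν : Set Ω} (h : ν ∈ M.successors t (M.node t ω)) :
    ∃ ω', ν = M.node (t + 1) ω' ∧ M.node t ω' = M.node t ω := by
  obtain ⟨⟨ω', rfl⟩, _⟩ := mem_successors.1 h
  exact ⟨ω', rfl, node_succ_mem_successors_iff.1 h⟩

/-- A choice is made at one representative of each node and copied to the whole node, where the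
invariance of `R` keeps it valid. -/
theorem exists_measurable_selection {α : Type*} [MeasurableSpace α] {R : Ω → α → Prop}
    (hR : ∀ ω ω', M.node t ω' = M.node t ω → ∀ a, R ω' a → R ω a) (h : ∀ ω, ∃ a, R ω a) :
    ∃ f : Ω → α, Measurable[M.filt t] f ∧ ∀ ω, R ω (f ω) := by
  have hne (ω : Ω) : (M.node t ω).Nonempty := ⟨ω, M.mem_node_self t ω⟩
  choose a ha using h
  refine ⟨fun ω => a (hne ω).some, measurable_of_node_eq fun ω ω' h => ?_, fun ω => ?_⟩
  · simp only [h]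
  · exact hR _ _ (node_eq_of_mem (hne ω).some_mem) _ (ha _)

end Nodes

/-! ### Sets of portfolios that are determined nodewise -/

section Local

variable {M} {t : ℕ} {A B : Set (Ω → Fin d → ℝ)}

theorem mem_portfolios {z : Ω → Fin d → ℝ} :
    z ∈ M.portfolios t ↔ ∀ ω ω', M.node t ω' = M.node t ω → z ω' = z ω :=
  measurable_iff_node

theorem portfolios_mono (M : CurrencyModel Ω T d) {s t : ℕ} (h : s ≤ t) :
    M.portfolios s ⊆ M.portfolios t :=
  fun _ hz => Measurable.mono hz (M.filt.mono h) le_rfl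

theorem add_mem_portfolios {x y : Ω → Fin d → ℝ} (hx : x ∈ M.portfolios t)
    (hy : y ∈ M.portfolios t) : x + y ∈ M.portfolios t := by
  rw [mem_portfolios] at *
  intro ω ω' h
  simp [hx _ _ h, hy _ _ h]

theorem sub_mem_portfolios {x y : Ω → Fin d → ℝ} (hx : x ∈ M.portfolios t)
    (hy : y ∈ M.portfolios t) : x - y ∈ M.portfolios t := by
  rw [mem_portfolios] at *
  intro ω ω' h
  simp [hx _ _ h, hy _ _ h]

theorem smul_mem_portfolios {a : Ω → ℝ} {x : Ω → Fin d → ℝ} (ha : Measurable[M.filt t] a)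
    (hx : x ∈ M.portfolios t) : (fun ω => a ω • x ω) ∈ M.portfolios t := by
  rw [mem_portfolios] at *
  rw [measurable_iff_node] at ha
  intro ω ω' h
  simp [hx _ _ h, ha _ _ h]

theorem const_mem_portfolios (M : CurrencyModel Ω T d) (t : ℕ) (v : Fin d → ℝ) :
    (fun _ => v) ∈ M.portfolios t := mem_portfolios.2 fun _ _ _ => rfl

theorem zero_mem_portfolios (M : CurrencyModel Ω T d) (t : ℕ) : 0 ∈ M.portfolios t :=
  M.const_mem_portfolios t 0

theorem sum_mem_portfolios {ι : Type*} {F : Finset ι} {x : ι → Ω → Fin d → ℝ}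
    (hx : ∀ i ∈ F, x i ∈ M.portfolios t) : ∑ i ∈ F, x i ∈ M.portfolios t := by
  rw [mem_portfolios]
  intro ω ω' h
  simp only [Finset.sum_apply]
  exact Finset.sum_congr rfl fun i hi => mem_portfolios.1 (hx i hi) _ _ h

variable (M) in
/-- A set of `𝓕_t`-measurable portfolios that is determined by its sections at the nodes. -/
structure IsLocal (t : ℕ) (A : Set (Ω → Fin d → ℝ)) : Prop where
  subset : A ⊆ M.portfolios t
  mem_of_forall : ∀ z ∈ M.portfolios t, (∀ ω, z ω ∈ nodeSection A (M.node t ω)) → z ∈ A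

theorem mem_nodeSection (hA : A ⊆ M.portfolios t) {z : Ω → Fin d → ℝ} (hz : z ∈ A) (ω : Ω) :
    z ω ∈ nodeSection A (M.node t ω) :=
  ⟨z, hz, fun _ h => mem_portfolios.1 (hA hz) _ _ (node_eq_of_mem h)⟩

theorem exists_of_mem_nodeSection {ω : Ω} {v : Fin d → ℝ} (h : v ∈ nodeSection A (M.node t ω)) :
    ∃ z ∈ A, z ω = v := by
  obtain ⟨z, hz, h⟩ := h
  exact ⟨z, hz, h ω (M.mem_node_self t ω)⟩

/-- Changing an element of a local set at one node. -/
theorem IsLocal.exists_paste (hA : IsLocal M t A) {z : Ω → Fin d → ℝ} (hz : z ∈ A) {ω : Ω}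
    {v : Fin d → ℝ} (hv : v ∈ nodeSection A (M.node t ω)) :
    (open Classical in fun ω' => if M.node t ω' = M.node t ω then v else z ω') ∈ A := by
  classical
  refine hA.mem_of_forall _ (mem_portfolios.2 fun ω₁ ω₂ h => ?_) fun ω₁ => ?_
  · simp only [h, mem_portfolios.1 (hA.subset hz) _ _ h]
  · by_cases h : M.node t ω₁ = M.node t ω
    · simpa [h] using hv
    · simpa [h] using mem_nodeSection hA.subset hz ω₁

/-- A value prescribed at one node has to be extended to a portfolio on all of `Ω`; the nonempty
fibres provide the values elsewhere. -/
theorem IsLocal.of_forall {F : Ω → Set (Fin d → ℝ)}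
    (hF : ∀ ω ω', M.node t ω' = M.node t ω → F ω' = F ω) (hne : ∀ ω, (F ω).Nonempty)
    (hA : ∀ z, z ∈ A ↔ z ∈ M.portfolios t ∧ ∀ ω, z ω ∈ F ω) :
    IsLocal M t A ∧ ∀ ω, nodeSection A (M.node t ω) = F ω := by
  classical
  have hsec (ω : Ω) : nodeSection A (M.node t ω) = F ω := by
    ext v
    constructor
    · intro hv
      obtain ⟨z, hz, rfl⟩ := exists_of_mem_nodeSection hv
      exact ((hA z).1 hz).2 ω
    · intro hv
      obtain ⟨f, hf, hfF⟩ := exists_measurable_selection (M := M) (t := t)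
        (R := fun ω' a => a ∈ F ω' ∧ (M.node t ω' = M.node t ω → a = v))
        (fun ω₁ ω₂ h a => by rw [hF _ _ h, h]; exact id)
        (fun ω' => by
          by_cases h : M.node t ω' = M.node t ω
          · exact ⟨v, hF _ _ h ▸ hv, fun _ => rfl⟩
          · exact ⟨_, (hne ω').some_mem, fun h' => absurd h' h⟩)
      exact ⟨f, (hA f).2 ⟨hf, fun ω' => (hfF ω').1⟩, fun ω' h => (hfF ω').2 (node_eq_of_mem h)⟩
  refine ⟨⟨fun z hz => ((hA z).1 hz).1, fun z hz h => (hA z).2 ⟨hz, fun ω => ?_⟩⟩, hsec⟩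
  rw [← hsec]
  exact h ω

theorem nodeSection_add (hA : A ⊆ M.portfolios t) (hB : B ⊆ M.portfolios t) (ω : Ω) :
    nodeSection (A + B) (M.node t ω) =
      nodeSection A (M.node t ω) + nodeSection B (M.node t ω) := by
  ext v
  constructor
  · intro hv
    obtain ⟨_, ⟨a, ha, b, hb, rfl⟩, rfl⟩ := exists_of_mem_nodeSection hv
    exact ⟨_, mem_nodeSection hA ha ω, _, mem_nodeSection hB hb ω, rfl⟩
  · rintro ⟨_, ⟨a, ha, ha'⟩, _, ⟨b, hb, hb'⟩, rfl⟩
    exact ⟨a + b, ⟨a, ha, b, hb, rfl⟩, fun ω' h => by simp [ha' ω' h, hb' ω' h]⟩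

/-- Decompositions found separately at the nodes are glued by a measurable selection of the first
summand. -/
theorem IsLocal.add (hA : IsLocal M t A) (hB : IsLocal M t B) : IsLocal M t (A + B) := by
  refine ⟨?_, fun z hz h => ?_⟩
  · rintro _ ⟨a, ha, b, hb, rfl⟩
    exact add_mem_portfolios (hA.subset ha) (hB.subset hb)
  · obtain ⟨f, hf, hfR⟩ := exists_measurable_selection (M := M) (t := t)
      (R := fun ω a => a ∈ nodeSection A (M.node t ω) ∧ z ω - a ∈ nodeSection B (M.node t ω))
      (fun ω₁ ω₂ h a => by rw [h, mem_portfolios.1 hz _ _ h]; exact id)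
      (fun ω => by
        have := h ω
        rw [nodeSection_add hA.subset hB.subset] at this
        obtain ⟨a, ha, b, hb, hab⟩ := this
        exact ⟨a, ha, by rwa [← hab, add_sub_cancel_left]⟩)
    exact ⟨f, hA.mem_of_forall f hf fun ω => (hfR ω).1, z - f,
      hB.mem_of_forall _ (sub_mem_portfolios hz hf) fun ω => (hfR ω).2, by simp⟩

theorem IsLocal.inter (hA : IsLocal M t A) (hB : IsLocal M t B) : IsLocal M t (A ∩ B) :=
  ⟨fun _ h => hA.subset h.1, fun z hz h =>
    ⟨hA.mem_of_forall z hz fun ω => nodeSection_mono Set.inter_subset_left _ (h ω),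
      hB.mem_of_forall z hz fun ω => nodeSection_mono Set.inter_subset_right _ (h ω)⟩⟩

/-- A common element of `A` and `B` fills in the other nodes; without one, the intersection could be
empty although the sections at `ω` meet. -/
theorem nodeSection_inter (hA : IsLocal M t A) (hB : IsLocal M t B) (hne : (A ∩ B).Nonempty)
    (ω : Ω) : nodeSection (A ∩ B) (M.node t ω) =
      nodeSection A (M.node t ω) ∩ nodeSection B (M.node t ω) := by
  obtain ⟨z, hz⟩ := hne
  refine (Set.subset_inter (nodeSection_mono Set.inter_subset_left _)
    (nodeSection_mono Set.inter_subset_right _)).antisymm fun v hv => ?_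
  exact ⟨_, ⟨hA.exists_paste hz.1 hv.1, hB.exists_paste hz.2 hv.2⟩,
    fun ω' h => by simp [node_eq_of_mem h]⟩

theorem IsLocal.inter_portfolios (hA : IsLocal M (t + 1) A) :
    IsLocal M t (A ∩ M.portfolios t) := by
  refine ⟨Set.inter_subset_right, fun z hz h => ⟨hA.mem_of_forall z
    (M.portfolios_mono t.le_succ hz) fun ω => ?_, hz⟩⟩
  obtain ⟨a, ha, h'⟩ := exists_of_mem_nodeSection (h ω)
  rw [← h']
  exact mem_nodeSection hA.subset ha.1 ω

/-- A portfolio known at `t` has a single value on the node, which must be admissible at every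
successor. This is where intersections over successors come from. -/
theorem nodeSection_inter_portfolios (hA : IsLocal M (t + 1) A)
    (hne : (A ∩ M.portfolios t).Nonempty) (ω : Ω) :
    nodeSection (A ∩ M.portfolios t) (M.node t ω) =
      ⋂ ν ∈ M.successors t (M.node t ω), nodeSection A ν := by
  classical
  obtain ⟨z, hz⟩ := hne
  ext v
  simp only [Set.mem_iInter]
  constructor
  · rintro ⟨a, ha, hv⟩ ν hν
    exact ⟨a, ha.1, fun ω' h => hv ω' ((mem_successors.1 hν).2 h)⟩
  · intro h
    have hL : (fun ω' => if M.node t ω' = M.node t ω then v else z ω') ∈ M.portfolios t :=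
      mem_portfolios.2 fun ω₁ ω₂ h => by simp only [h, mem_portfolios.1 hz.2 _ _ h]
    refine ⟨_, ⟨hA.mem_of_forall _ (M.portfolios_mono t.le_succ hL) fun ω₁ => ?_, hL⟩,
      fun ω' h => by simp [node_eq_of_mem h]⟩
    by_cases h' : M.node t ω₁ = M.node t ω
    · simpa [h'] using h _ (node_succ_mem_successors_iff.2 h')
    · simpa [h'] using mem_nodeSection hA.subset hz.1 ω₁

end Local

end CurrencyModel

namespace CurrencyModel

variable {Ω : Type*} [Finite Ω] [MeasurableSpace Ω] {T d : ℕ} {M : CurrencyModel Ω T d} {t : ℕ}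

/-! ### Solvency cones -/

/-- The transfers can be selected node by node, so solvency is a linear system at each `ω`. -/
theorem mem_solvencyCone_iff (ht : t ≤ T) {x : Ω → Fin d → ℝ} :
    x ∈ M.solvencyCone t ↔ x ∈ M.portfolios t ∧ ∀ ω, ∃ β : Fin d → Fin d → ℝ,
      (∀ j k, 0 ≤ β j k) ∧
        ∀ k, 0 ≤ x ω k + ∑ j, β j k - ∑ j, β k j * M.rate t k j ω := by
  constructor
  · rintro ⟨hx, y, hy, ⟨β, hβ, hβ0, hβy⟩, hy0⟩
    exact ⟨hx, fun ω => ⟨fun j k => β j k ω, fun j k => hβ0 j k ω,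
      fun k => (hy0 ω k).trans_eq (hβy ω k)⟩⟩
  · rintro ⟨hx, h⟩
    obtain ⟨β, hβ, hβR⟩ := exists_measurable_selection (M := M) (t := t)
      (α := Fin d → Fin d → ℝ) (R := fun ω β => (∀ j k, 0 ≤ β j k) ∧
        ∀ k, 0 ≤ x ω k + ∑ j, β j k - ∑ j, β k j * M.rate t k j ω)
      (fun ω ω' hω β => by
        simp only [mem_portfolios.1 hx _ _ hω,
          fun k j => eq_of_node_eq (M.rate_measurable t ht k j) hω, imp_self]) h
    rw [measurable_iff_node] at hβ
    refine ⟨hx, fun ω k => x ω k + ∑ j, β ω j k - ∑ j, β ω k j * M.rate t k j ω,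
      mem_portfolios.2 fun ω ω' hω => ?_, ⟨fun j k ω => β ω j k, fun j k => ?_,
        fun j k ω => (hβR ω).1 j k, fun ω k => rfl⟩, fun ω => (hβR ω).2⟩
    · ext k
      simp only [mem_portfolios.1 hx _ _ hω, hβ _ _ hω,
          fun k j => eq_of_node_eq (M.rate_measurable t ht k j) hω]
    · exact measurable_of_node_eq fun ω ω' hω => by simp only [hβ _ _ hω]

theorem mem_solvencyCone_of_nonneg (ht : t ≤ T) {x : Ω → Fin d → ℝ} (hx : x ∈ M.portfolios t)
    (h0 : ∀ ω k, 0 ≤ x ω k) : x ∈ M.solvencyCone t :=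
  (mem_solvencyCone_iff ht).2 ⟨hx, fun ω => ⟨0, by simp, by simpa using h0 ω⟩⟩

theorem zero_mem_solvencyCone (ht : t ≤ T) : 0 ∈ M.solvencyCone t :=
  mem_solvencyCone_of_nonneg ht (M.zero_mem_portfolios t) (by simp)

theorem add_mem_solvencyCone (ht : t ≤ T) {x y : Ω → Fin d → ℝ} (hx : x ∈ M.solvencyCone t)
    (hy : y ∈ M.solvencyCone t) : x + y ∈ M.solvencyCone t := by
  rw [mem_solvencyCone_iff ht] at *
  refine ⟨add_mem_portfolios hx.1 hy.1, fun ω => ?_⟩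
  obtain ⟨β, hβ, hβx⟩ := hx.2 ω
  obtain ⟨γ, hγ, hγy⟩ := hy.2 ω
  refine ⟨β + γ, fun j k => add_nonneg (hβ j k) (hγ j k), fun k => ?_⟩
  have := add_nonneg (hβx k) (hγy k)
  simp only [Pi.add_apply, Finset.sum_add_distrib, add_mul]
  linarith

/-- The factor may be random, as long as it is known at `t`: exercise fractions will take this role.
-/
theorem smul_mem_solvencyCone (ht : t ≤ T) {x : Ω → Fin d → ℝ} (hx : x ∈ M.solvencyCone t)
    {a : Ω → ℝ} (ha : Measurable[M.filt t] a) (ha0 : ∀ ω, 0 ≤ a ω) :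
    (fun ω => a ω • x ω) ∈ M.solvencyCone t := by
  rw [mem_solvencyCone_iff ht] at *
  refine ⟨smul_mem_portfolios ha hx.1, fun ω => ?_⟩
  obtain ⟨β, hβ, hβx⟩ := hx.2 ω
  refine ⟨a ω • β, fun j k => mul_nonneg (ha0 ω) (hβ j k), fun k => ?_⟩
  have := mul_nonneg (ha0 ω) (hβx k)
  simp only [Pi.smul_apply, smul_eq_mul, ← Finset.mul_sum, mul_assoc]
  linarith

theorem sum_mem_solvencyCone (ht : t ≤ T) {ι : Type*} {F : Finset ι} {x : ι → Ω → Fin d → ℝ}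
    (hx : ∀ i ∈ F, x i ∈ M.solvencyCone t) : ∑ i ∈ F, x i ∈ M.solvencyCone t := by
  classical
  induction F using Finset.induction_on with
  | empty => exact zero_mem_solvencyCone ht
  | insert a F ha ih =>
    rw [Finset.sum_insert ha]
    exact add_mem_solvencyCone ht (hx a (by simp)) (ih fun i hi => hx i (by simp [hi]))

variable (M) in
/-- A local set all of whose sections at nodes are polyhedral. -/
structure IsLocallyPolyhedral (t : ℕ) (A : Set (Ω → Fin d → ℝ)) : Prop extends IsLocal M t A where
  polyhedral : ∀ ω, IsPolyhedral (nodeSection A (M.node t ω))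

theorem solvencyCone_isLocallyPolyhedral (M : CurrencyModel Ω T d) (ht : t ≤ T) :
    IsLocallyPolyhedral M t (M.solvencyCone t) := by
  obtain ⟨h1, h2⟩ := IsLocal.of_forall (M := M) (t := t) (A := M.solvencyCone t)
    (F := fun ω => {v | ∃ β : Fin d → Fin d → ℝ, (∀ j k, 0 ≤ β j k) ∧
        ∀ k, 0 ≤ v k + ∑ j, β j k - ∑ j, β k j * M.rate t k j ω})
    (fun ω ω' hω => by
        simp only [fun k j => eq_of_node_eq (M.rate_measurable t ht k j) hω])
    (fun ω => ⟨0, 0, by simp, by simp⟩) (fun z => mem_solvencyCone_iff ht)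
  refine ⟨h1, fun ω => ?_⟩
  rw [h2]
  let f (j k : Fin d) : (Fin d → ℝ) × (Fin d → Fin d → ℝ) →ₗ[ℝ] ℝ :=
    (LinearMap.proj k ∘ₗ LinearMap.proj j) ∘ₗ LinearMap.snd ℝ _ _
  let g (k : Fin d) : (Fin d → ℝ) × (Fin d → Fin d → ℝ) →ₗ[ℝ] ℝ :=
    LinearMap.proj k ∘ₗ LinearMap.fst ℝ _ _ + ∑ j, f j k - ∑ j, M.rate t k j ω • f k j
  convert IsPolyhedral.exists_proj ((IsPolyhedral.iInter fun j => IsPolyhedral.iInter fun k =>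
    IsPolyhedral.halfSpace (f j k) 0).inter (IsPolyhedral.iInter fun k =>
      IsPolyhedral.halfSpace (g k) 0)) using 1
  ext v
  simp [f, g, mul_comm, LinearMap.sum_apply]

theorem IsLocallyPolyhedral.add {A B : Set (Ω → Fin d → ℝ)} (hA : IsLocallyPolyhedral M t A)
    (hB : IsLocallyPolyhedral M t B) : IsLocallyPolyhedral M t (A + B) :=
  ⟨hA.toIsLocal.add hB.toIsLocal, fun ω => by
    rw [nodeSection_add hA.subset hB.subset]
    exact (hA.polyhedral ω).add (hB.polyhedral ω)⟩

theorem IsLocallyPolyhedral.inter {A B : Set (Ω → Fin d → ℝ)} (hA : IsLocallyPolyhedral M t A)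
    (hB : IsLocallyPolyhedral M t B) (hne : (A ∩ B).Nonempty) :
    IsLocallyPolyhedral M t (A ∩ B) :=
  ⟨hA.toIsLocal.inter hB.toIsLocal, fun ω => by
    rw [nodeSection_inter hA.toIsLocal hB.toIsLocal hne]
    exact (hA.polyhedral ω).inter (hB.polyhedral ω)⟩

theorem IsLocallyPolyhedral.inter_portfolios {A : Set (Ω → Fin d → ℝ)}
    (hA : IsLocallyPolyhedral M (t + 1) A) (hne : (A ∩ M.portfolios t).Nonempty) :
    IsLocallyPolyhedral M t (A ∩ M.portfolios t) :=
  ⟨hA.toIsLocal.inter_portfolios, fun ω => by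
    rw [nodeSection_inter_portfolios hA.toIsLocal hne]
    refine IsPolyhedral.biInter _ fun ν hν => ?_
    obtain ⟨ω', rfl, _⟩ := exists_of_mem_successors hν
    exact hA.polyhedral ω'⟩

theorem singleton_isLocallyPolyhedral {x : Ω → Fin d → ℝ} (hx : x ∈ M.portfolios t) :
    IsLocallyPolyhedral M t {x} ∧ ∀ ω, nodeSection {x} (M.node t ω) = {x ω} := by
  obtain ⟨h1, h2⟩ := IsLocal.of_forall (M := M) (t := t) (A := {x})
    (F := fun ω => {x ω}) (fun ω ω' hω => by rw [mem_portfolios.1 hx _ _ hω])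
    (fun ω => ⟨x ω, rfl⟩) (fun z => by
      simp only [Set.mem_singleton_iff, ← funext_iff]
      exact ⟨fun h => ⟨h ▸ hx, h⟩, fun h => h.2⟩)
  exact ⟨⟨h1, fun ω => by rw [h2]; exact IsPolyhedral.singleton _⟩, h2⟩

/-! ### Deferred solvency cones -/

theorem deferredCone_final (M : CurrencyModel Ω T d) : M.deferredCone T = M.solvencyCone T := by
  ext z
  constructor
  · rintro ⟨_, y, _, hy, _, h0⟩
    simpa [h0] using hy
  · intro hz
    exact ⟨hz.1, 0, fun s _ _ => M.zero_mem_portfolios s, by simpa using hz,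
      fun s h h' => absurd h (by omega), rfl⟩

/-- Dynamic programming: after the first trade there remains a portfolio known at `t` that can be
liquidated from `t + 1` on. This carries polyhedrality backwards in time. -/
theorem deferredCone_eq_add (M : CurrencyModel Ω T d) (ht : t < T) :
    M.deferredCone t =
      M.solvencyCone t + (M.deferredCone (t + 1) ∩ M.portfolios t) := by
  ext z
  constructor
  · rintro ⟨hz, y, hy, hzy, hyy, h0⟩
    have hy1 := hy t le_rfl ht
    refine ⟨z - y (t + 1), hzy, y (t + 1), ⟨⟨M.portfolios_mono t.le_succ hy1, y,
      fun s h h' => hy s (by omega) h', ?_, fun s h h' => hyy s (by omega) h', h0⟩, hy1⟩, by simp⟩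
    exact hyy (t + 1) (by omega) (by omega)
  · rintro ⟨k, hk, w, ⟨⟨_, y, hy, hwy, hyy, h0⟩, hwt⟩, rfl⟩
    -- The liquidation of `w` from time `t + 1` uses `y` only from `t + 2` on, so the entry at `t +
    -- 1` is free to hold `w`.
    refine ⟨add_mem_portfolios hk.1 hwt, Function.update y (t + 1) w, fun s h h' => ?_, by simpa,
      fun s h h' => ?_, ?_⟩
    · rcases h.eq_or_lt with rfl | h
      · simpa using hwt
      · rw [Function.update_of_ne (by omega)]
        exact hy s (by omega) h'
    · rw [Function.update_of_ne (a := s + 1) (by omega)]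
      rcases (show t + 1 ≤ s by omega).eq_or_lt with rfl | h
      · simpa using hwy
      · rw [Function.update_of_ne (by omega)]
        exact hyy s (by omega) h'
    · rw [Function.update_of_ne (by omega)]
      exact h0

theorem mem_deferredCone_of_nonneg (ht : t ≤ T) {x : Ω → Fin d → ℝ} (hx : x ∈ M.portfolios t)
    (h0 : ∀ ω k, 0 ≤ x ω k) : x ∈ M.deferredCone t :=
  ⟨hx, 0, fun s _ _ => M.zero_mem_portfolios s, by
    simpa using mem_solvencyCone_of_nonneg ht hx h0,
    fun s _ h => by simpa using zero_mem_solvencyCone h, rfl⟩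

theorem zero_mem_deferredCone (ht : t ≤ T) : 0 ∈ M.deferredCone t :=
  mem_deferredCone_of_nonneg ht (M.zero_mem_portfolios t) (by simp)

theorem solvencyCone_subset_deferredCone : M.solvencyCone t ⊆ M.deferredCone t :=
  fun x hx => ⟨hx.1, 0, fun s _ _ => M.zero_mem_portfolios s, by simpa,
    fun s _ h => by simpa using zero_mem_solvencyCone h, rfl⟩

theorem add_mem_deferredCone (ht : t ≤ T) {x y : Ω → Fin d → ℝ} (hx : x ∈ M.deferredCone t)
    (hy : y ∈ M.deferredCone t) : x + y ∈ M.deferredCone t := by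
  obtain ⟨hx, u, hu, hxu, huu, hu0⟩ := hx
  obtain ⟨hy, v, hv, hyv, hvv, hv0⟩ := hy
  refine ⟨add_mem_portfolios hx hy, u + v, fun s h h' => add_mem_portfolios (hu s h h') (hv s h h'),
    ?_, fun s h h' => ?_, by simp [hu0, hv0]⟩
  · convert add_mem_solvencyCone ht hxu hyv using 1
    simp only [Pi.add_apply]
    abel
  · convert add_mem_solvencyCone h' (huu s h h') (hvv s h h') using 1
    simp only [Pi.add_apply]
    abel

theorem smul_mem_deferredCone (ht : t ≤ T) {x : Ω → Fin d → ℝ} (hx : x ∈ M.deferredCone t)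
    {a : ℝ} (ha : 0 ≤ a) : a • x ∈ M.deferredCone t := by
  obtain ⟨hx, u, hu, hxu, huu, hu0⟩ := hx
  refine ⟨smul_mem_portfolios measurable_const hx, fun s => a • u s,
    fun s h h' => smul_mem_portfolios measurable_const (hu s h h'), ?_, fun s h h' => ?_,
    by simp [hu0]⟩
  · rw [← smul_sub]
    exact smul_mem_solvencyCone ht hxu measurable_const fun _ => ha
  · rw [← smul_sub]
    exact smul_mem_solvencyCone h' (huu s h h') measurable_const fun _ => ha

theorem deferredCone_isLocallyPolyhedral (M : CurrencyModel Ω T d) (ht : t ≤ T) :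
    IsLocallyPolyhedral M t (M.deferredCone t) := by
  induction ht using Nat.decreasingInduction with
  | self => rw [deferredCone_final]; exact M.solvencyCone_isLocallyPolyhedral le_rfl
  | of_succ t ht ih =>
    rw [M.deferredCone_eq_add ht]
    exact (M.solvencyCone_isLocallyPolyhedral ht.le).add
      (ih.inter_portfolios ⟨0, zero_mem_deferredCone ht, M.zero_mem_portfolios t⟩)

theorem deferredCone_subset (ht : t ≤ T) : M.deferredCone t ⊆ M.portfolios t :=
  (M.deferredCone_isLocallyPolyhedral ht).subset

/-! ### Sections of the deferred solvency cones -/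

section Section

variable {ω : Ω}

theorem section_smul_mem (ht : t ≤ T) (r : ℝ) (hr : 0 ≤ r) :
    ∀ c ∈ nodeSection (M.deferredCone t) (M.node t ω),
      r • c ∈ nodeSection (M.deferredCone t) (M.node t ω) := by
  rintro c ⟨z, hz, h⟩
  exact ⟨r • z, smul_mem_deferredCone ht hz hr, fun ω' hω' => by simp [h ω' hω']⟩

theorem zero_mem_section (ht : t ≤ T) :
    0 ∈ nodeSection (M.deferredCone t) (M.node t ω) :=
  ⟨0, zero_mem_deferredCone ht, by simp⟩

theorem mem_section_of_nonneg (ht : t ≤ T) {v : Fin d → ℝ} (hv : ∀ k, 0 ≤ v k) :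
    v ∈ nodeSection (M.deferredCone t) (M.node t ω) :=
  ⟨fun _ => v, mem_deferredCone_of_nonneg ht (M.const_mem_portfolios t v) fun _ => hv, by simp⟩

theorem dualCone_nonneg (ht : t ≤ T) {y : Fin d → ℝ} (hy : y ∈ M.dualCone t (M.node t ω))
    (j : Fin d) : 0 ≤ y j := by
  have := hy (Pi.single j 1) (mem_section_of_nonneg ht fun k => by
    by_cases h : k = j <;> simp [h])
  simpa using this

/-- One unit of currency `k` is worth at most its exchange rate. -/
theorem dualCone_le_rate_mul (ht : t ≤ T) {y : Fin d → ℝ} (hy : y ∈ M.dualCone t (M.node t ω))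
    (j k : Fin d) : y k ≤ M.rate t j k ω * y j := by
  have hmem : (fun ω' => Pi.single j (M.rate t j k ω') - Pi.single k 1 : Ω → Fin d → ℝ) ∈
      M.deferredCone t := by
    refine solvencyCone_subset_deferredCone ((mem_solvencyCone_iff ht).2
      ⟨mem_portfolios.2 fun ω₁ ω₂ h => by
        rw [eq_of_node_eq (M.rate_measurable t ht j k) h], fun ω' => ?_⟩)
    -- The only transfer buys one unit of `k` for currency `j`, which repays the debt in `k`.
    refine ⟨fun a b => if a = j ∧ b = k then 1 else 0, fun a b => by dsimp only; split_ifs <;> simp,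
      fun i => ?_⟩
    have h1 : ∑ a, (if a = j ∧ i = k then (1 : ℝ) else 0) = if i = k then 1 else 0 := by
      by_cases h : i = k <;> simp [h]
    have h2 : ∑ b, (if i = j ∧ b = k then (1 : ℝ) else 0) * M.rate t i b ω' =
        if i = j then M.rate t j k ω' else 0 := by
      by_cases h : i = j <;> simp [h]
    rw [h1, h2]
    simp [Pi.single_apply]
  have := hy _ (mem_nodeSection (deferredCone_subset ht) hmem ω)
  rw [dotProduct_sub, dotProduct_single, dotProduct_single] at this
  linarith

/-- Every coordinate lies between `0` and a multiple of `y j`. Hence nonzero dual vectors can be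
normalized in currency `j`. -/
theorem eq_zero_of_mem_dualCone (ht : t ≤ T) {y : Fin d → ℝ}
    (hy : y ∈ M.dualCone t (M.node t ω)) {j : Fin d} (hj : y j = 0) : y = 0 := by
  ext k
  refine le_antisymm ?_ (dualCone_nonneg ht hy k)
  simpa [hj] using dualCone_le_rate_mul ht hy j k

theorem smul_mem_dualCone {μ : Set Ω} {y : Fin d → ℝ} (hy : y ∈ M.dualCone t μ) {r : ℝ}
    (hr : 0 ≤ r) : r • y ∈ M.dualCone t μ := fun x hx => by
  rw [smul_dotProduct]
  exact smul_nonneg hr (hy x hx)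

theorem normalize_mem_sigmaSet {μ : Set Ω} {y : Fin d → ℝ} (hy : y ∈ M.dualCone t μ) {j : Fin d}
    (hj : 0 < y j) : (y j)⁻¹ • y ∈ sigmaSet j (M.dualCone t μ) :=
  ⟨smul_mem_dualCone hy (by positivity), by simp [hj.ne']⟩

/-- Without arbitrage, a debt cannot be liquidated. -/
theorem NoArbitrage.neg_single_notMem (hM : M.NoArbitrage) (ht : t ≤ T) (ω : Ω) (j : Fin d) :
    Pi.single j (-1) ∉ nodeSection (M.deferredCone t) (M.node t ω) := by
  classical
  intro hmem
  have hpaste := (M.deferredCone_isLocallyPolyhedral ht).exists_paste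
    (zero_mem_deferredCone ht) hmem
  obtain ⟨hz, y, hy, hzy, hyy, h0⟩ := hpaste
  set e : Ω → Fin d → ℝ := fun ω' => if M.node t ω' = M.node t ω then Pi.single j 1 else 0
  have hz' : (fun ω' => if M.node t ω' = M.node t ω then Pi.single j (-1)
      else (0 : Ω → Fin d → ℝ) ω') = -e := by
    ext ω' k
    by_cases h : M.node t ω' = M.node t ω <;> simp [e, h, Pi.single_apply, apply_ite]
  rw [hz'] at hz hzy
  have he : e ∈ M.portfolios t := mem_portfolios.2 fun ω₁ ω₂ h => by simp only [e, h]
  -- If the debt `-e` can be liquidated by `y`, then holding nothing up to time `t` and `y + e`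
  -- afterwards ends with `e` for free. For `t = T` the strategy is zero and `-e` itself is solvent.
  refine hM ⟨fun s => if t < s ∧ s ≤ T then y s + e else 0, ⟨?_, fun s hs => ?_, ?_⟩,
    fun s hs => ?_, ?_, e, M.portfolios_mono ht he, ?_, fun ω' k => ?_, ?_⟩
  · simpa using M.zero_mem_portfolios 0
  · by_cases h : t < s + 1 ∧ s + 1 ≤ T
    · simp only [h, and_self, if_true]
      exact add_mem_portfolios (hy s (by omega) (by omega)) (M.portfolios_mono (by omega) he)
    · simpa only [h, if_false] using M.zero_mem_portfolios s
  · simp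
  · rcases lt_trichotomy s t with h | rfl | h
    · simp only [show ¬ (t < s ∧ s ≤ T) by omega, show ¬ (t < s + 1 ∧ s + 1 ≤ T) by omega,
        if_false, sub_zero]
      exact zero_mem_solvencyCone hs.le
    · simp only [show ¬ (s < s ∧ s ≤ T) by omega, show (s < s + 1 ∧ s + 1 ≤ T) by omega,
        and_self, if_false, if_true]
      convert hzy using 1
      abel
    · simp only [show (t < s ∧ s ≤ T) by omega, show (t < s + 1 ∧ s + 1 ≤ T) by omega,
        and_self, if_true]
      convert hyy s h hs.le using 1
      abel
  · simp
  · intro h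
    have := congrFun (congrFun h ω) j
    simp [e] at this
  · by_cases h : M.node t ω' = M.node t ω
    · by_cases hk : k = j <;> simp [e, h, hk]
    · simp [e, h]
  · rcases ht.eq_or_lt with rfl | h
    · simpa [h0] using hzy
    · simpa [h, h0] using hyy T h le_rfl

theorem NoArbitrage.sigmaSet_dualCone_nonempty (hM : M.NoArbitrage) (ht : t ≤ T) (ω : Ω)
    (j : Fin d) : (sigmaSet j (M.dualCone t (M.node t ω))).Nonempty :=
  ((M.deferredCone_isLocallyPolyhedral ht).polyhedral ω).sigmaSet_polarNeg_nonempty j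
    (section_smul_mem ht) ⟨0, zero_mem_section ht⟩ (hM.neg_single_notMem ht ω j)

end Section

end CurrencyModel

namespace CurrencyModel

variable {Ω : Type*} [Finite Ω] [MeasurableSpace Ω] {T d : ℕ} {M : CurrencyModel Ω T d} {t : ℕ}
  {ξ : ℕ → Ω → Fin d → ℝ}

/-! ### The sets of the backward induction -/

theorem Zset_final : M.Zset ξ T = M.Uset ξ T := by
  rw [Zset, if_neg (lt_irrefl T)]

theorem Wset_of_lt (ht : t < T) : M.Wset ξ t = M.Zset ξ (t + 1) ∩ M.portfolios t := if_pos ht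

theorem Vset_of_lt (ht : t < T) : M.Vset ξ t = M.Wset ξ t + M.deferredCone t := if_pos ht

theorem Zset_of_lt (ht : t < T) : M.Zset ξ t = M.Uset ξ t ∩ M.Vset ξ t := by
  rw [Zset, if_pos ht, Vset_of_lt ht, Wset_of_lt ht]

theorem Uset_isLocallyPolyhedral (hξ : M.IsAdapted ξ) (ht : t ≤ T) :
    IsLocallyPolyhedral M t (M.Uset ξ t) :=
  (singleton_isLocallyPolyhedral (hξ t ht)).1.add (M.deferredCone_isLocallyPolyhedral ht)

theorem nodeSection_Uset (hξ : M.IsAdapted ξ) (ht : t ≤ T) (ω : Ω) :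
    nodeSection (M.Uset ξ t) (M.node t ω) =
      {ξ t ω} + nodeSection (M.deferredCone t) (M.node t ω) := by
  rw [Uset, nodeSection_add (by simpa using hξ t ht) (deferredCone_subset ht),
    (singleton_isLocallyPolyhedral (hξ t ht)).2]

theorem mem_Uset {z : Ω → Fin d → ℝ} : z ∈ M.Uset ξ t ↔ z - ξ t ∈ M.deferredCone t := by
  simp only [Uset, Set.singleton_add, Set.mem_image]
  exact ⟨fun ⟨q, hq, h⟩ => by rwa [← h, add_sub_cancel_left], fun h => ⟨_, h, by simp⟩⟩

/-- A sufficiently large constant portfolio superhedges the payoff. -/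
theorem exists_const_mem_Zset (hξ : M.IsAdapted ξ) :
    ∃ v : Fin d → ℝ, ∀ t ≤ T, (fun _ => v) ∈ M.Zset ξ t := by
  obtain ⟨m, hm⟩ := (Set.finite_range
    fun p : Fin (T + 1) × Ω × Fin d => ξ p.1 p.2.1 p.2.2).bddAbove
  have hU (t : ℕ) (ht : t ≤ T) : (fun _ _ => m) ∈ M.Uset ξ t := by
    refine mem_Uset.2 (mem_deferredCone_of_nonneg ht
      (sub_mem_portfolios (M.const_mem_portfolios t _) (hξ t ht)) fun ω k => sub_nonneg.2 ?_)
    exact hm ⟨(⟨t, by omega⟩, ω, k), rfl⟩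
  refine ⟨fun _ => m, fun t ht => ?_⟩
  induction ht using Nat.decreasingInduction with
  | self => rw [Zset_final]; exact hU T le_rfl
  | of_succ t ht ih =>
    rw [Zset_of_lt ht, Vset_of_lt ht, Wset_of_lt ht]
    exact ⟨hU t ht.le, _, ⟨ih, M.const_mem_portfolios t _⟩, 0, zero_mem_deferredCone ht.le,
      by simp⟩

theorem Wset_nonempty (hξ : M.IsAdapted ξ) (ht : t < T) : (M.Wset ξ t).Nonempty := by
  obtain ⟨v, hv⟩ := exists_const_mem_Zset hξ
  rw [Wset_of_lt ht]
  exact ⟨_, hv _ ht, M.const_mem_portfolios t _⟩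

theorem Zset_nonempty (hξ : M.IsAdapted ξ) (ht : t ≤ T) : (M.Zset ξ t).Nonempty := by
  obtain ⟨v, hv⟩ := exists_const_mem_Zset hξ
  exact ⟨_, hv _ ht⟩

theorem Zset_isLocallyPolyhedral (hξ : M.IsAdapted ξ) (ht : t ≤ T) :
    IsLocallyPolyhedral M t (M.Zset ξ t) := by
  induction ht using Nat.decreasingInduction with
  | self => rw [Zset_final]; exact Uset_isLocallyPolyhedral hξ le_rfl
  | of_succ t ht ih =>
    have hne := Zset_nonempty hξ ht.le
    have hWne := Wset_nonempty hξ ht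
    rw [Zset_of_lt ht, Vset_of_lt ht] at *
    rw [Wset_of_lt ht] at *
    exact (Uset_isLocallyPolyhedral hξ ht.le).inter
      ((ih.inter_portfolios hWne).add (M.deferredCone_isLocallyPolyhedral ht.le)) hne

theorem Wset_isLocallyPolyhedral (hξ : M.IsAdapted ξ) (ht : t < T) :
    IsLocallyPolyhedral M t (M.Wset ξ t) := by
  have hWne := Wset_nonempty hξ ht
  rw [Wset_of_lt ht] at *
  exact (Zset_isLocallyPolyhedral hξ ht).inter_portfolios hWne

theorem Vset_isLocallyPolyhedral (hξ : M.IsAdapted ξ) (ht : t < T) :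
    IsLocallyPolyhedral M t (M.Vset ξ t) := by
  rw [Vset_of_lt ht]
  exact (Wset_isLocallyPolyhedral hξ ht).add (M.deferredCone_isLocallyPolyhedral ht.le)

theorem nodeSection_Vset (hξ : M.IsAdapted ξ) (ht : t < T) (ω : Ω) :
    nodeSection (M.Vset ξ t) (M.node t ω) = nodeSection (M.Wset ξ t) (M.node t ω) +
      nodeSection (M.deferredCone t) (M.node t ω) := by
  rw [Vset_of_lt ht, nodeSection_add (Wset_isLocallyPolyhedral hξ ht).subset
    (deferredCone_subset ht.le)]

theorem nodeSection_Wset (hξ : M.IsAdapted ξ) (ht : t < T) (ω : Ω) :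
    nodeSection (M.Wset ξ t) (M.node t ω) =
      ⋂ ν ∈ M.successors t (M.node t ω), nodeSection (M.Zset ξ (t + 1)) ν := by
  have hWne := Wset_nonempty hξ ht
  rw [Wset_of_lt ht] at *
  exact nodeSection_inter_portfolios (Zset_isLocallyPolyhedral hξ ht).toIsLocal hWne ω

theorem nodeSection_Zset (hξ : M.IsAdapted ξ) (ht : t < T) (ω : Ω) :
    nodeSection (M.Zset ξ t) (M.node t ω) = nodeSection (M.Uset ξ t) (M.node t ω) ∩
      nodeSection (M.Vset ξ t) (M.node t ω) := by
  have hne := Zset_nonempty hξ ht.le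
  rw [Zset_of_lt ht] at *
  exact nodeSection_inter (Uset_isLocallyPolyhedral hξ ht.le).toIsLocal
    (Vset_isLocallyPolyhedral hξ ht).toIsLocal hne ω

theorem nodeSection_Zset_nonempty (hξ : M.IsAdapted ξ) (ht : t ≤ T) (ω : Ω) :
    (nodeSection (M.Zset ξ t) (M.node t ω)).Nonempty := by
  obtain ⟨z, hz⟩ := Zset_nonempty hξ ht
  exact ⟨_, mem_nodeSection (Zset_isLocallyPolyhedral hξ ht).subset hz ω⟩

theorem nodeSection_Wset_nonempty (hξ : M.IsAdapted ξ) (ht : t < T) (ω : Ω) :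
    (nodeSection (M.Wset ξ t) (M.node t ω)).Nonempty := by
  obtain ⟨z, hz⟩ := Wset_nonempty hξ ht
  exact ⟨_, mem_nodeSection (Wset_isLocallyPolyhedral hξ ht).subset hz ω⟩

/-! ### The support functions -/

section Fun

variable {ω : Ω} {y : Fin d → ℝ}

theorem section_add_mem (ht : t ≤ T) {a b : Fin d → ℝ}
    (ha : a ∈ nodeSection (M.deferredCone t) (M.node t ω))
    (hb : b ∈ nodeSection (M.deferredCone t) (M.node t ω)) :
    a + b ∈ nodeSection (M.deferredCone t) (M.node t ω) := by
  obtain ⟨x, hx, h⟩ := ha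
  obtain ⟨z, hz, h'⟩ := hb
  exact ⟨x + z, add_mem_deferredCone ht hx hz, fun ω' hω' => by simp [h ω' hω', h' ω' hω']⟩

theorem add_section_add_mem (ht : t ≤ T) (A : Set (Fin d → ℝ)) :
    ∀ a ∈ A + nodeSection (M.deferredCone t) (M.node t ω),
      ∀ c ∈ nodeSection (M.deferredCone t) (M.node t ω),
        a + c ∈ A + nodeSection (M.deferredCone t) (M.node t ω) := by
  rintro _ ⟨a, ha, b, hb, rfl⟩ c hc
  exact ⟨a, ha, b + c, section_add_mem ht hb hc, (add_assoc a b c).symm⟩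

theorem nodeSection_Zset_add_mem (hξ : M.IsAdapted ξ) (ht : t ≤ T) :
    ∀ a ∈ nodeSection (M.Zset ξ t) (M.node t ω),
      ∀ c ∈ nodeSection (M.deferredCone t) (M.node t ω),
        a + c ∈ nodeSection (M.Zset ξ t) (M.node t ω) := by
  intro a ha c hc
  rcases ht.lt_or_eq with h | rfl
  · rw [nodeSection_Zset hξ h, nodeSection_Uset hξ ht, nodeSection_Vset hξ h] at *
    exact ⟨add_section_add_mem ht _ a ha.1 c hc, add_section_add_mem ht _ a ha.2 c hc⟩
  · rw [Zset_final, nodeSection_Uset hξ ht] at *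
    exact add_section_add_mem ht _ a ha c hc

theorem mem_dualCone_of_Zfun_lt_top (hξ : M.IsAdapted ξ) (ht : t ≤ T)
    (h : M.Zfun ξ t (M.node t ω) y < ⊤) : y ∈ M.dualCone t (M.node t ω) :=
  mem_polarNeg_of_supportFun_lt_top (nodeSection_Zset_nonempty hξ ht ω)
    (nodeSection_Zset_add_mem hξ ht) (section_smul_mem ht) h

theorem mem_dualCone_of_Vfun_lt_top (hξ : M.IsAdapted ξ) (ht : t < T)
    (h : M.Vfun ξ t (M.node t ω) y < ⊤) : y ∈ M.dualCone t (M.node t ω) := by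
  rw [Vfun, nodeSection_Vset hξ ht] at h
  exact mem_polarNeg_of_supportFun_lt_top
    ((nodeSection_Wset_nonempty hξ ht ω).add ⟨0, zero_mem_section ht.le⟩)
    (add_section_add_mem ht.le _) (section_smul_mem ht.le) h

theorem mem_dualCone_of_Ufun_lt_top (hξ : M.IsAdapted ξ) (ht : t ≤ T)
    (h : M.Ufun ξ t (M.node t ω) y < ⊤) : y ∈ M.dualCone t (M.node t ω) := by
  rw [Ufun, nodeSection_Uset hξ ht] at h
  exact mem_polarNeg_of_supportFun_lt_top
    ((Set.singleton_nonempty _).add ⟨0, zero_mem_section ht⟩)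
    (add_section_add_mem ht _) (section_smul_mem ht) h

theorem Ufun_eq (hξ : M.IsAdapted ξ) (ht : t ≤ T) (hy : y ∈ M.dualCone t (M.node t ω)) :
    M.Ufun ξ t (M.node t ω) y = ((-(y ⬝ᵥ ξ t ω) : ℝ) : EReal) := by
  rw [Ufun, nodeSection_Uset hξ ht, supportFun_neg_add_cone (zero_mem_section ht) hy,
    supportFun_neg_singleton]

theorem Vfun_eq_Wfun (hξ : M.IsAdapted ξ) (ht : t < T) (hy : y ∈ M.dualCone t (M.node t ω)) :
    M.Vfun ξ t (M.node t ω) y = M.Wfun ξ t (M.node t ω) y := by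
  rw [Vfun, nodeSection_Vset hξ ht, supportFun_neg_add_cone (zero_mem_section ht.le) hy, Wfun]

theorem Zset_subset_Uset (ht : t ≤ T) : M.Zset ξ t ⊆ M.Uset ξ t := by
  rcases ht.lt_or_eq with h | rfl
  · rw [Zset_of_lt h]
    exact Set.inter_subset_left
  · rw [Zset_final]

theorem exists_Zfun_eq_coe (hξ : M.IsAdapted ξ) (ht : t ≤ T)
    (hy : y ∈ M.dualCone t (M.node t ω)) : ∃ c : ℝ, M.Zfun ξ t (M.node t ω) y = c := by
  refine exists_supportFun_eq_coe (nodeSection_Zset_nonempty hξ ht ω) (lt_of_le_of_lt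
    (supportFun_neg_mono (nodeSection_mono (Zset_subset_Uset ht) _)) ?_)
  rw [← Ufun, Ufun_eq hξ ht hy]
  exact EReal.coe_lt_top _

/-- A vector of `𝓠_t^*` is nonnegative on `𝓠_{t+1} ∩ 𝓛_t`, hence splits over the successors into
vectors of the cones `𝓠_{t+1}^{ν*}`. The functions `Z_{t+1}` are finite there, and their sum bounds
`W_t`. -/
theorem exists_Wfun_eq_coe (hξ : M.IsAdapted ξ) (ht : t < T)
    (hy : y ∈ M.dualCone t (M.node t ω)) : ∃ c : ℝ, M.Wfun ξ t (M.node t ω) y = c := by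
  refine exists_supportFun_eq_coe (nodeSection_Wset_nonempty hξ ht ω) ?_
  have hne : (M.deferredCone (t + 1) ∩ M.portfolios t).Nonempty :=
    ⟨0, zero_mem_deferredCone ht, M.zero_mem_portfolios t⟩
  have hQ := M.deferredCone_isLocallyPolyhedral (Nat.succ_le_of_lt ht)
  have h0 : ∀ x ∈ ⋂ ν ∈ M.successors t (M.node t ω), nodeSection (M.deferredCone (t + 1)) ν,
      0 ≤ y ⬝ᵥ x := by
    intro x hx
    rw [← nodeSection_inter_portfolios hQ.toIsLocal hne] at hx
    refine hy x (nodeSection_mono ?_ _ hx)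
    rw [M.deferredCone_eq_add ht]
    exact fun z hz => ⟨0, zero_mem_solvencyCone ht.le, z, hz, by simp⟩
  obtain ⟨w, c, rfl, hc, hw⟩ := IsPolyhedral.exists_split_biInter
    (M.successors_nonempty t ω) (fun ν hν => by
      obtain ⟨ω', rfl, _⟩ := exists_of_mem_successors hν
      exact hQ.polyhedral ω')
    ⟨0, by
      simp only [Set.mem_iInter]
      exact fun ν _ => ⟨0, hQ.mem_of_forall 0 (M.zero_mem_portfolios _)
        fun ω => zero_mem_section ht, by simp⟩⟩ h0
  have hwQ : ∀ ν ∈ M.successors t (M.node t ω), ∃ b : ℝ, M.Zfun ξ (t + 1) ν (w ν) = b := by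
    intro ν hν
    obtain ⟨ω', rfl, _⟩ := exists_of_mem_successors hν
    refine exists_Zfun_eq_coe hξ ht (mem_polarNeg_of_supportFun_lt_top ⟨0, zero_mem_section ht⟩
      (fun a ha c hc => section_add_mem ht ha hc) (section_smul_mem ht)
      (supportFun_neg_lt_top_of_le (hw _ hν)))
  choose! b hb using hwQ
  refine supportFun_neg_lt_top_of_le (c := ∑ ν ∈ M.successors t (M.node t ω), -b ν)
    fun a ha => ?_
  rw [nodeSection_Wset hξ ht] at ha
  simp only [Set.mem_iInter] at ha
  rw [sum_dotProduct]
  exact Finset.sum_le_sum fun ν hν => supportFun_neg_le_iff.1 (hb ν hν).le a (ha ν hν)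

end Fun

/-! ### Existence of the recursive steps -/

theorem ereal_coe_sum {ι : Type*} (F : Finset ι) (f : ι → ℝ) :
    ((∑ i ∈ F, f i : ℝ) : EReal) = ∑ i ∈ F, (f i : EReal) := by
  classical
  induction F using Finset.induction_on with
  | empty => simp
  | insert a F ha ih => rw [Finset.sum_insert ha, Finset.sum_insert ha, EReal.coe_add, ih]

/-- Splitting the support function of `-(𝓤 ∩ 𝓥)` at a node. -/
theorem exists_split_Zfun (hξ : M.IsAdapted ξ) (ht : t < T) {ω : Ω} {j : Fin d} {y : Fin d → ℝ}
    (hy : y ∈ sigmaSet j (M.dualCone t (M.node t ω))) :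
    ∃ l ∈ Set.Icc (0 : ℝ) 1, ∃ x ∈ sigmaSet j (M.dualCone t (M.node t ω)),
      ∃ S ∈ sigmaSet j (M.dualCone t (M.node t ω)), y = l • S + (1 - l) • x ∧
        M.Zfun ξ t (M.node t ω) y = (l : EReal) * M.Ufun ξ t (M.node t ω) S +
          ((1 - l : ℝ) : EReal) * M.Vfun ξ t (M.node t ω) x := by
  obtain ⟨c, hc⟩ := exists_Zfun_eq_coe (ξ := ξ) hξ ht.le hy.1
  have hne := nodeSection_Zset_nonempty hξ ht.le ω
  have hc' := hc
  rw [Zfun, nodeSection_Zset hξ ht] at hc'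
  rw [nodeSection_Zset hξ ht] at hne
  obtain ⟨y₁, y₂, c₁, c₂, rfl, rfl, h₁, h₂⟩ := exists_supportFun_inter
    ((Uset_isLocallyPolyhedral hξ ht.le).polyhedral ω)
    ((Vset_isLocallyPolyhedral hξ ht).polyhedral ω) hne hc'
  have hy₁ : y₁ ∈ M.dualCone t (M.node t ω) :=
    mem_dualCone_of_Ufun_lt_top hξ ht.le (h₁.trans_lt (EReal.coe_lt_top _))
  have hy₂ : y₂ ∈ M.dualCone t (M.node t ω) :=
    mem_dualCone_of_Vfun_lt_top hξ ht (h₂.trans_lt (EReal.coe_lt_top _))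
  have hj : y₁ j + y₂ j = 1 := hy.2
  have hj₁ := dualCone_nonneg ht.le hy₁ j
  have hj₂ := dualCone_nonneg ht.le hy₂ j
  have hU := hne.mono Set.inter_subset_left
  have hV := hne.mono Set.inter_subset_right
  -- The `j`-th coordinate is pulled out as a weight. If it is zero, the whole piece vanishes and
  -- any normalized dual vector with finite value serves; the vector being split is at hand.
  have key (A : Set (Fin d → ℝ)) (hA : A.Nonempty) (w : Fin d → ℝ) (b : ℝ)
      (hw : w ∈ M.dualCone t (M.node t ω)) (hb : supportFun (-A) w = b)
      (hfin : ∀ v ∈ M.dualCone t (M.node t ω), ∃ b' : ℝ, supportFun (-A) v = b') :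
      ∃ S ∈ sigmaSet j (M.dualCone t (M.node t ω)), w = w j • S ∧
        (b : EReal) = (w j : EReal) * supportFun (-A) S := by
    rcases (dualCone_nonneg ht.le hw j).eq_or_lt with h | h
    · have hw0 := eq_zero_of_mem_dualCone ht.le hw h.symm
      obtain ⟨b', hb'⟩ := hfin _ hy.1
      refine ⟨y₁ + y₂, hy, by simp [hw0], ?_⟩
      have := supportFun_neg_smul le_rfl hA hb'
      rw [zero_smul, ← hw0, hb] at this
      rw [this, hb', ← EReal.coe_mul, h]
    · refine ⟨_, normalize_mem_sigmaSet hw h, by rw [smul_inv_smul₀ h.ne'], ?_⟩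
      rw [supportFun_neg_smul (inv_nonneg.2 h.le) hA hb, ← EReal.coe_mul,
        mul_inv_cancel_left₀ h.ne']
  obtain ⟨S, hS, hS₁, hS₂⟩ := key _ hU y₁ c₁ hy₁ h₁ fun v hv => ⟨_, Ufun_eq hξ ht.le hv⟩
  obtain ⟨x, hx, hx₁, hx₂⟩ := key _ hV y₂ c₂ hy₂ h₂ fun v hv => by
    rw [← Vfun, Vfun_eq_Wfun hξ ht hv]
    exact exists_Wfun_eq_coe hξ ht hv
  have hj' : 1 - y₁ j = y₂ j := by linarith
  refine ⟨y₁ j, ⟨hj₁, by linarith⟩, x, hx, S, hS, ?_, ?_⟩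
  · rw [hj', ← hS₁, ← hx₁]
  · rw [hj', hc, EReal.coe_add, hS₂, hx₂, Ufun, Vfun]

/-- Splitting the support function of `-𝓦` along the successors of a node. -/
theorem exists_split_Wfun (hM : M.NoArbitrage) (hξ : M.IsAdapted ξ) (ht : t < T) {ω : Ω}
    {j : Fin d} {x : Fin d → ℝ} (hx : x ∈ sigmaSet j (M.dualCone t (M.node t ω))) :
    ∃ (q : Set Ω → ℝ) (y' : Set Ω → Fin d → ℝ),
      (∀ ν ∈ M.successors t (M.node t ω), q ν ∈ Set.Icc (0 : ℝ) 1) ∧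
      (∀ ν ∈ M.successors t (M.node t ω), y' ν ∈ sigmaSet j (M.dualCone (t + 1) ν)) ∧
      M.Wfun ξ t (M.node t ω) x =
        ∑ ν ∈ M.successors t (M.node t ω), (q ν : EReal) * M.Zfun ξ (t + 1) ν (y' ν) ∧
      x = ∑ ν ∈ M.successors t (M.node t ω), q ν • y' ν ∧
      ∑ ν ∈ M.successors t (M.node t ω), q ν = 1 := by
  obtain ⟨b, hb⟩ := exists_Wfun_eq_coe (ξ := ξ) hξ ht hx.1
  have hne := nodeSection_Wset_nonempty hξ ht ω
  have hb' := hb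
  rw [Wfun, nodeSection_Wset hξ ht] at hb'
  rw [nodeSection_Wset hξ ht] at hne
  obtain ⟨w, c, hxw, rfl, hw⟩ := exists_supportFun_biInter (M.successors_nonempty t ω)
    (fun ν hν => by
      obtain ⟨ω', rfl, _⟩ := exists_of_mem_successors hν
      exact (Zset_isLocallyPolyhedral hξ ht).polyhedral ω') hne hb'
  have hwd : ∀ ν ∈ M.successors t (M.node t ω), 0 ≤ w ν j ∧
      ∃ y' ∈ sigmaSet j (M.dualCone (t + 1) ν), w ν = w ν j • y' ∧
        (c ν : EReal) = (w ν j : EReal) * M.Zfun ξ (t + 1) ν y' := by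
    intro ν hν
    have hwν := hw ν hν
    obtain ⟨ω', rfl, _⟩ := exists_of_mem_successors hν
    have hZne := nodeSection_Zset_nonempty hξ (Nat.succ_le_of_lt ht) ω'
    have hd := mem_dualCone_of_Zfun_lt_top hξ ht (hwν.trans_lt (EReal.coe_lt_top _))
    refine ⟨dualCone_nonneg ht hd j, ?_⟩
    rcases (dualCone_nonneg ht hd j).eq_or_lt with h | h
    · have hw0 := eq_zero_of_mem_dualCone ht hd h.symm
      -- A successor of weight zero still needs a normalized dual vector, which the absence of
      -- arbitrage provides.
      obtain ⟨y', hy'⟩ := hM.sigmaSet_dualCone_nonempty (Nat.succ_le_of_lt ht) ω' j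
      obtain ⟨b', hb'⟩ := exists_Zfun_eq_coe (ξ := ξ) hξ ht hy'.1
      refine ⟨y', hy', by simp [hw0], ?_⟩
      have := supportFun_neg_smul le_rfl hZne hb'
      rw [zero_smul, ← hw0, hwν] at this
      rw [this, hb', ← EReal.coe_mul, h]
    · refine ⟨_, normalize_mem_sigmaSet hd h, by rw [smul_inv_smul₀ h.ne'], ?_⟩
      rw [Zfun, supportFun_neg_smul (inv_nonneg.2 h.le) hZne hwν, ← EReal.coe_mul,
        mul_inv_cancel_left₀ h.ne']
  choose! hw0 y' hy' hwy hcy using hwd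
  have hsum : ∑ ν ∈ M.successors t (M.node t ω), w ν j = 1 := by
    have := congrFun hxw j
    rw [hx.2, Finset.sum_apply] at this
    exact this.symm
  refine ⟨fun ν => w ν j, y', fun ν hν => ⟨hw0 ν hν, ?_⟩, hy', ?_, ?_, hsum⟩
  · rw [← hsum]
    exact Finset.single_le_sum (f := fun ν => w ν j) hw0 hν
  · rw [hb, ereal_coe_sum]
    exact Finset.sum_congr rfl hcy
  · exact hxw.trans (Finset.sum_congr rfl hwy)

theorem exists_isStep (hM : M.NoArbitrage) (hξ : M.IsAdapted ξ) (ht : t < T) {μ : Set Ω}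
    (hμ : μ ∈ M.nodes t) {j : Fin d} {y : Fin d → ℝ} (hy : y ∈ sigmaSet j (M.dualCone t μ)) :
    ∃ l x S q y', M.IsStep ξ j t μ y l x S q y' := by
  obtain ⟨ω, rfl⟩ := hμ
  obtain ⟨l, hl, x, hx, S, hS, hyl, hZ⟩ := exists_split_Zfun hξ ht hy
  obtain ⟨q, y', hq, hy', hW, hxq, hsum⟩ := exists_split_Wfun hM hξ ht hx
  have hV := Vfun_eq_Wfun (ξ := ξ) hξ ht hx.1
  obtain ⟨b, hb⟩ := exists_Wfun_eq_coe (ξ := ξ) hξ ht hx.1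
  exact ⟨l, x, S, q, y', hl, ⟨by
    change M.Vfun ξ t (M.node t ω) x < ⊤
    rw [hV, hb]
    exact EReal.coe_lt_top b, hx.2⟩, hS, hZ, hyl, hq, hy', hV, hW, hxq, hsum⟩

end CurrencyModel

namespace CurrencyModel

variable {Ω : Type*} [Finite Ω] [MeasurableSpace Ω] {T d : ℕ} {M : CurrencyModel Ω T d} {t : ℕ}
  {ξ : ℕ → Ω → Fin d → ℝ}

/-! ### Superhedging against gradual exercise -/

/-- The stopping time that is constantly `t`. -/
def stopAt (Ω : Type*) (t : ℕ) : ℕ → Ω → ℝ := fun s _ => if s = t then 1 else 0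

theorem stopAt_isMixedStoppingTime (M : CurrencyModel Ω T d) (ht : t ≤ T) :
    M.IsMixedStoppingTime (stopAt Ω t) := by
  refine ⟨fun s _ => measurable_const, fun s _ ω => ?_, fun ω => ?_⟩
  · by_cases h : s = t <;> simp [stopAt, h]
  · simp [stopAt, ht]

/-- Before `t`, exercise at `T` and exercise at `t` look alike, so the portfolio at `t` must also
allow delivery of `ξ_t`, with the later trades as liquidation: this gives `𝓤_t`. Not exercising at
`t < T` leads to `𝓩_{t+1}` by a solvent trade: this gives `𝓥_t`. -/
theorem IsSellerHedge.mem_Zset {Y : (ℕ → Ω → ℝ) → ℕ → Ω → Fin d → ℝ}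
    (hY : M.IsSellerHedge ξ Y) (ht : t ≤ T) : Y (stopAt Ω T) t ∈ M.Zset ξ t := by
  obtain ⟨hS, hK, hN⟩ := hY
  have hmixed {s : ℕ} (hs : s ≤ T) := stopAt_isMixedStoppingTime M hs
  have hport (s r : ℕ) (hs : s ≤ T) (hr : r ≤ T) : Y (stopAt Ω s) r ∈ M.portfolios r := by
    cases r with
    | zero => exact (hS _ (hmixed hs)).1
    | succ r => exact M.portfolios_mono r.le_succ ((hS _ (hmixed hs)).2.1 r (by omega))
  have hU (t : ℕ) (ht : t ≤ T) : Y (stopAt Ω T) t ∈ M.Uset ξ t := by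
    have heq : Y (stopAt Ω T) t = Y (stopAt Ω t) t := by
      ext1 ω
      refine hN _ _ (hmixed le_rfl) (hmixed ht) t ht ω fun s hs => ?_
      simp [stopAt, hs.ne, (hs.trans_le ht).ne]
    rw [heq, mem_Uset]
    have hξ : (fun ω => stopAt Ω t t ω • ξ t ω) = ξ t := by ext; simp [stopAt]
    have h1 := hK _ (hmixed ht) t ht
    rw [hξ] at h1
    refine ⟨?_, Y (stopAt Ω t), fun s _ h => (hS _ (hmixed ht)).2.1 s h.le, h1, fun s h h' => ?_,
      (hS _ (hmixed ht)).2.2⟩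
    · have := add_mem_portfolios h1.1 ((hS _ (hmixed ht)).2.1 t ht)
      simpa using this
    · have h2 := hK _ (hmixed ht) s h'
      have h0 : (fun ω => stopAt Ω t s ω • ξ s ω) = 0 := by ext; simp [stopAt, h.ne']
      rwa [h0, sub_zero] at h2
  induction ht using Nat.decreasingInduction with
  | self => rw [Zset_final]; exact hU T le_rfl
  | of_succ t ht ih =>
    rw [Zset_of_lt ht, Vset_of_lt ht, Wset_of_lt ht]
    refine ⟨hU t ht.le, _, ⟨ih, (hS _ (hmixed le_rfl)).2.1 t ht.le⟩,
      Y (stopAt Ω T) t - Y (stopAt Ω T) (t + 1), ?_, by simp⟩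
    have h2 := hK _ (hmixed le_rfl) t ht.le
    have h0 : (fun ω => stopAt Ω T t ω • ξ t ω) = 0 := by ext; simp [stopAt, ht.ne]
    rw [h0, sub_zero] at h2
    exact solvencyCone_subset_deferredCone h2

/-- Portfolios that hedge immediate exercise at each date, with deferred rebalancing. -/
theorem exists_deferred_strategy {z : Ω → Fin d → ℝ} (hz : z ∈ M.Zset ξ 0) :
    ∃ w : ℕ → Ω → Fin d → ℝ, w 0 = z ∧ (∀ t ≤ T, w t ∈ M.Zset ξ t) ∧
      (∀ t < T, w (t + 1) ∈ M.portfolios t ∧ w t - w (t + 1) ∈ M.deferredCone t) ∧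
      w (T + 1) = 0 := by
  have key : ∀ t (z : Ω → Fin d → ℝ), ∃ w, t < T → z ∈ M.Zset ξ t → w ∈ M.Zset ξ (t + 1) ∧
      w ∈ M.portfolios t ∧ z - w ∈ M.deferredCone t := by
    intro t z
    by_cases h : t < T ∧ z ∈ M.Zset ξ t
    · have hz := h.2
      rw [Zset_of_lt h.1, Vset_of_lt h.1, Wset_of_lt h.1] at hz
      obtain ⟨_, w, hw, q, hq, rfl⟩ := hz
      exact ⟨w, fun _ _ => ⟨hw.1, hw.2, by simpa using hq⟩⟩
    · exact ⟨0, fun h1 h2 => absurd ⟨h1, h2⟩ h⟩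
  choose f hf using key
  let w : ℕ → Ω → Fin d → ℝ := fun t => Nat.rec z (fun t w => f t w) t
  have hw (t : ℕ) (ht : t ≤ T) : w t ∈ M.Zset ξ t := by
    induction t with
    | zero => exact hz
    | succ t ih => exact (hf t (w t) ht (ih (by omega))).1
  refine ⟨fun t => if t ≤ T then w t else 0, by simp [w], fun t ht => by simpa [ht] using hw t ht,
    fun t ht => ?_, by simp⟩
  simp only [ht.le, show t + 1 ≤ T from ht, if_true]
  exact (hf t (w t) ht (hw t ht.le)).2

/-- The unexercised fraction is held in `w`. The fraction exercised at `s` goes into the liquidation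
`α s` of `w s - ξ s`, and the fraction left after `s` also runs the liquidation `β s` of `w s - w (s
+ 1)`. -/
theorem exists_isSellerHedge (hξ : M.IsAdapted ξ) {z : Ω → Fin d → ℝ} (hz : z ∈ M.Zset ξ 0) :
    ∃ Y, M.IsSellerHedge ξ Y ∧ ∀ χ, Y χ 0 = z := by
  obtain ⟨w, hw0, hwZ, hwQ, hwT⟩ := exists_deferred_strategy hz
  have hα : ∀ t, ∃ y : ℕ → Ω → Fin d → ℝ, t ≤ T →
      (∀ s, t ≤ s → s < T → y (s + 1) ∈ M.portfolios s) ∧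
      w t - ξ t - y (t + 1) ∈ M.solvencyCone t ∧
      (∀ s, t < s → s ≤ T → y s - y (s + 1) ∈ M.solvencyCone s) ∧ y (T + 1) = 0 := by
    intro t
    by_cases ht : t ≤ T
    · obtain ⟨_, y, hy⟩ := mem_Uset.1 (Zset_subset_Uset ht (hwZ t ht))
      exact ⟨y, fun _ => hy⟩
    · exact ⟨0, fun h => absurd h ht⟩
  have hβ : ∀ t, ∃ y : ℕ → Ω → Fin d → ℝ,
      (t ≤ T → ∀ s, t ≤ s → s < T → y (s + 1) ∈ M.portfolios s) ∧
      (t < T → w t - w (t + 1) - y (t + 1) ∈ M.solvencyCone t) ∧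
      (∀ s, t < s → s ≤ T → y s - y (s + 1) ∈ M.solvencyCone s) ∧ y (T + 1) = 0 := by
    intro t
    by_cases ht : t < T
    · obtain ⟨_, y, hy1, hy2, hy3, hy4⟩ := (hwQ t ht).2
      exact ⟨y, fun _ => hy1, fun _ => hy2, hy3, hy4⟩
    · exact ⟨0, fun _ s _ _ => M.zero_mem_portfolios s, fun h => absurd h ht,
        fun s h h' => absurd h (by omega), rfl⟩
  choose α hα using hα
  choose β hβ1 hβ2 hβ3 hβ0 using hβ
  -- The fraction not exercised before `t`. It involves `χ` only at dates before `t`, which yields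
  -- both predictability and non-anticipation.
  let κ : (ℕ → Ω → ℝ) → ℕ → Ω → ℝ := fun χ t ω => 1 - ∑ r ∈ Finset.range t, χ r ω
  have hκ {χ χ' : ℕ → Ω → ℝ} {t : ℕ} {ω ω' : Ω} (h : ∀ s < t, χ s ω = χ' s ω') :
      κ χ t ω = κ χ' t ω' := by
    simp only [κ]
    congr 1
    exact Finset.sum_congr rfl fun r hr => h r (Finset.mem_range.1 hr)
  have hκm {χ : ℕ → Ω → ℝ} (hχ : M.IsMixedStoppingTime χ) {t : ℕ} (ht : t ≤ T) :
      Measurable[M.filt t] (κ χ (t + 1)) := measurable_of_node_eq fun ω ω' h =>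
    hκ fun s hs => eq_of_node_eq (hχ.1 s (by omega)) (node_eq_of_le (by omega) h)
  have hκT {χ : ℕ → Ω → ℝ} (hχ : M.IsMixedStoppingTime χ) (ω : Ω) : κ χ (T + 1) ω = 0 := by
    have := hχ.2.2 ω
    rw [← Nat.range_succ_eq_Icc_zero] at this
    simp [κ, this]
  have hκ0 {χ : ℕ → Ω → ℝ} (hχ : M.IsMixedStoppingTime χ) {t : ℕ} (ht : t ≤ T + 1) (ω : Ω) :
      0 ≤ κ χ t ω := by
    rw [← hκT hχ ω]
    refine sub_le_sub_left (Finset.sum_le_sum_of_subset_of_nonneg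
      (Finset.range_mono ht) fun i hi _ => ?_) _
    exact (hχ.2.1 i (by simpa [Nat.lt_succ_iff] using hi) ω).1
  let G : (ℕ → Ω → ℝ) → ℕ → ℕ → Ω → Fin d → ℝ := fun χ s t ω =>
    χ s ω • α s t ω + κ χ (s + 1) ω • β s t ω
  refine ⟨fun χ t => (fun ω => κ χ t ω • w t ω) + ∑ s ∈ Finset.range t, G χ s t,
    ⟨fun χ hχ => ⟨?_, fun t ht => ?_, ?_⟩, fun χ hχ t ht => ?_, fun χ χ' _ _ t _ ω h => ?_⟩,
    fun χ => ?_⟩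
  · simpa [κ, hw0] using (Zset_isLocallyPolyhedral hξ (Nat.zero_le T)).subset hz
  · rcases ht.lt_or_eq with h | rfl
    · refine add_mem_portfolios (smul_mem_portfolios (hκm hχ ht) (hwQ t h).1)
        (sum_mem_portfolios fun s hs => ?_)
      have hs' : s ≤ t := by simpa [Nat.lt_succ_iff] using hs
      exact add_mem_portfolios
        (smul_mem_portfolios ((hχ.1 s (by omega)).mono (M.filt.mono hs') le_rfl)
          ((hα s (by omega)).1 t hs' h))
        (smul_mem_portfolios ((hκm hχ (t := s) (by omega)).mono (M.filt.mono hs') le_rfl)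
          (hβ1 s (by omega) t hs' h))
    · beta_reduce
      rw [hwT]
      refine add_mem_portfolios (by simpa using M.const_mem_portfolios t 0)
        (sum_mem_portfolios fun s hs => ?_)
      have hs' : s ≤ t := by simpa [Nat.lt_succ_iff] using hs
      have : G χ s (t + 1) = 0 := by
        ext1 ω
        simp [G, (hα s hs').2.2.2, hβ0 s]
      rw [this]
      exact M.zero_mem_portfolios t
  · beta_reduce
    rw [hwT]
    have : ∀ s ∈ Finset.range (T + 1), G χ s (T + 1) = 0 := fun s hs => by
      ext1 ω
      simp [G, (hα s (by simpa [Nat.lt_succ_iff] using hs)).2.2.2, hβ0 s]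
    rw [Finset.sum_eq_zero this]
    ext
    simp
  -- As `κ χ t = χ t + κ χ (t + 1)`, the holding in `w t` divides: one part pays `ξ t` and opens `α
  -- t`, the other moves to `w (t + 1)` and opens `β t`. The accounts opened earlier advance by one
  -- date.
  · have e : (fun ω => κ χ t ω • w t ω) + ∑ s ∈ Finset.range t, G χ s t -
        (fun ω => χ t ω • ξ t ω) -
        ((fun ω => κ χ (t + 1) ω • w (t + 1) ω) + ∑ s ∈ Finset.range (t + 1), G χ s (t + 1)) =
        ((fun ω => χ t ω • (w t - ξ t - α t (t + 1)) ω) +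
          fun ω => κ χ (t + 1) ω • (w t - w (t + 1) - β t (t + 1)) ω) +
        ∑ s ∈ Finset.range t, ((fun ω => χ s ω • (α s t - α s (t + 1)) ω) +
          fun ω => κ χ (s + 1) ω • (β s t - β s (t + 1)) ω) := by
      have e1 (ω : Ω) : κ χ t ω = κ χ (t + 1) ω + χ t ω := by
        simp only [κ, Finset.sum_range_succ]
        ring
      ext ω k
      simp only [Finset.sum_range_succ, G, Pi.add_apply, Pi.sub_apply, Finset.sum_apply,
        Pi.smul_apply, smul_eq_mul, e1 ω, mul_sub, Finset.sum_add_distrib,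
        Finset.sum_sub_distrib]
      ring
    rw [e]
    have hχ0 (s : ℕ) (hs : s ≤ T) (ω : Ω) : 0 ≤ χ s ω := (hχ.2.1 s hs ω).1
    refine add_mem_solvencyCone ht (add_mem_solvencyCone ht
      (smul_mem_solvencyCone ht (hα t ht).2.1 (hχ.1 t ht) (hχ0 t ht)) ?_)
      (sum_mem_solvencyCone ht fun s hs => ?_)
    -- At the last date nothing is left over, so no rebalancing is required there.
    · rcases ht.lt_or_eq with h | rfl
      · exact smul_mem_solvencyCone ht (hβ2 t h) (hκm hχ ht) (hκ0 hχ (by omega))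
      · simp only [hκT hχ, zero_smul]
        exact zero_mem_solvencyCone le_rfl
    · have hs' : s < t := Finset.mem_range.1 hs
      exact add_mem_solvencyCone ht
        (smul_mem_solvencyCone ht ((hα s (by omega)).2.2.1 t hs' ht)
          ((hχ.1 s (by omega)).mono (M.filt.mono hs'.le) le_rfl) (hχ0 s (by omega)))
        (smul_mem_solvencyCone ht (hβ3 s t hs' ht)
          ((hκm hχ (t := s) (by omega)).mono (M.filt.mono hs'.le) le_rfl) (hκ0 hχ (by omega)))
  · simp only [Pi.add_apply, Finset.sum_apply, G]
    congr 1
    · rw [hκ h]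
    · refine Finset.sum_congr rfl fun s hs => ?_
      have hs' := Finset.mem_range.1 hs
      rw [h s hs', hκ fun r hr => h r (by omega)]
  · ext
    simp [κ, hw0]

/-! ### The ask price and its dual representation -/

instance instIsProbabilityMeasureP (M : CurrencyModel Ω T d) : IsProbabilityMeasure M.P :=
  M.isProbabilityMeasure_P

theorem nonempty (M : CurrencyModel Ω T d) : Nonempty Ω := M.P.nonempty_of_neZero

theorem const_mem_Zset_iff (hξ : M.IsAdapted ξ) {v : Fin d → ℝ} :
    (fun _ => v) ∈ M.Zset ξ 0 ↔ v ∈ nodeSection (M.Zset ξ 0) Set.univ := by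
  have hZ := Zset_isLocallyPolyhedral hξ (Nat.zero_le T)
  obtain ⟨ω⟩ := M.nonempty
  refine ⟨fun h => ⟨_, h, by simp⟩, fun h =>
    hZ.mem_of_forall _ (M.const_mem_portfolios 0 v) fun ω => by rwa [node_zero]⟩

theorem askPrice_eq_sInf (hξ : M.IsAdapted ξ) (j : Fin d) :
    M.askPrice ξ j = sInf {r | ∃ x : ℝ, r = (x : EReal) ∧
      Pi.single j x ∈ nodeSection (M.Zset ξ 0) Set.univ} := by
  unfold askPrice
  congr 1
  ext r
  refine exists_congr fun x => and_congr_right fun _ => ?_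
  rw [← const_mem_Zset_iff hξ]
  constructor
  · rintro ⟨Y, hY, h⟩
    have := hY.mem_Zset (Nat.zero_le T)
    rwa [funext (h _ (stopAt_isMixedStoppingTime M le_rfl))] at this
  · intro h
    obtain ⟨Y, hY, h0⟩ := exists_isSellerHedge hξ h
    exact ⟨Y, hY, fun χ _ ω => by rw [h0]⟩

/-- With `y j = 1` the other coordinates lie between `0` and the exchange rates. -/
theorem isCompact_sigmaSet_dualCone (ht : t ≤ T) (ω : Ω) (j : Fin d) :
    IsCompact (sigmaSet j (M.dualCone t (M.node t ω))) := by
  refine IsCompact.of_isClosed_subset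
    (isCompact_univ_pi fun k => isCompact_Icc (a := (0 : ℝ)) (b := M.rate t j k ω)) ?_ ?_
  · have : sigmaSet j (M.dualCone t (M.node t ω)) =
        (⋂ x ∈ nodeSection (M.deferredCone t) (M.node t ω), {y : Fin d → ℝ | 0 ≤ y ⬝ᵥ x}) ∩
          {y | y j = 1} := by
      ext y
      simp [sigmaSet, dualCone, polarNeg]
    rw [this]
    refine (isClosed_biInter fun x _ => isClosed_le continuous_const ?_).inter
      (isClosed_eq (continuous_apply j) continuous_const)
    exact continuous_finsetSum _ fun i _ => (continuous_apply i).mul continuous_const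
  · intro y hy k _
    refine ⟨dualCone_nonneg ht hy.1 k, ?_⟩
    have := dualCone_le_rate_mul ht hy.1 j k
    rwa [hy.2, mul_one] at this

theorem lowerSemicontinuous_supportFun (A : Set (Fin d → ℝ)) :
    LowerSemicontinuous (supportFun A) := by
  refine lowerSemicontinuous_biSup fun a _ => Continuous.lowerSemicontinuous ?_
  exact continuous_coe_real_ereal.comp
    (continuous_finsetSum _ fun i _ => (continuous_apply i).mul continuous_const)

/-- A lower semicontinuous function attains its minimum on the compact set of normalized dual
vectors; outside the dual cone `Z_0` is infinite, so the minimum is global. -/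
theorem exists_isInitialChoice (hM : M.NoArbitrage) (hξ : M.IsAdapted ξ) (j : Fin d) :
    ∃ y, M.IsInitialChoice ξ j y := by
  obtain ⟨ω⟩ := M.nonempty
  obtain ⟨y, hy, hmin⟩ := LowerSemicontinuousOn.exists_isMinOn
    (hM.sigmaSet_dualCone_nonempty (Nat.zero_le T) ω j)
    (isCompact_sigmaSet_dualCone (Nat.zero_le T) ω j)
    ((lowerSemicontinuous_supportFun (-nodeSection (M.Zset ξ 0) (M.node 0 ω))).lowerSemicontinuousOn
      _)
  refine ⟨y, by rwa [node_zero] at hy, fun s hs => EReal.neg_le_neg_iff.2 ?_⟩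
  by_cases h : M.Zfun ξ 0 Set.univ s < ⊤
  · rw [← M.node_zero ω] at h ⊢
    exact hmin ⟨mem_dualCone_of_Zfun_lt_top hξ (Nat.zero_le T) h, hs.2⟩
  · rw [not_lt_top_iff.1 h]
    exact le_top

/-- The ask price is the maximal value of `-Z^ad_0`. -/
theorem IsInitialChoice.askPrice_eq (hξ : M.IsAdapted ξ) {j : Fin d} {y : Fin d → ℝ}
    (hy : M.IsInitialChoice ξ j y) : M.askPrice ξ j = -M.Zfun ξ 0 Set.univ y := by
  obtain ⟨ω⟩ := M.nonempty
  have hyd := hy.1.1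
  rw [← M.node_zero ω] at hyd
  obtain ⟨c, hc⟩ := exists_Zfun_eq_coe (ξ := ξ) hξ (Nat.zero_le T) hyd
  rw [node_zero] at hc
  have key (x : ℝ) : Pi.single j x ∈ nodeSection (M.Zset ξ 0) Set.univ ↔ -c ≤ x := by
    constructor
    · intro h
      have := supportFun_neg_le_iff.1 hc.le _ h
      rwa [dotProduct_single, hy.1.2, one_mul] at this
    · intro hx
      by_contra hmem
      have hpoly := (Zset_isLocallyPolyhedral hξ (Nat.zero_le T)).polyhedral ω
      rw [node_zero] at hpoly
      -- Some defining inequality `p` excludes `x e^j`, and its normal lies in the dual cone. A zero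
      -- normal would force `p.2 ≤ 0 < p.2`; otherwise the normalized normal contradicts the
      -- maximality at `y`.
      obtain ⟨s, hs⟩ := hpoly.exists_vectors
      rw [hs] at hmem
      simp only [Set.mem_ofPred_eq, not_forall, not_le] at hmem
      obtain ⟨p, hp, hpx⟩ := hmem
      have hle : ∀ a ∈ nodeSection (M.Zset ξ 0) Set.univ, p.2 ≤ p.1 ⬝ᵥ a := fun a ha => by
        rw [hs] at ha
        exact ha p hp
      have hd : p.1 ∈ M.dualCone 0 (M.node 0 ω) :=
        mem_dualCone_of_Zfun_lt_top hξ (Nat.zero_le T) (by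
          rw [node_zero]
          exact supportFun_neg_lt_top_of_le hle)
      rw [dotProduct_single] at hpx
      obtain ⟨a, ha⟩ := nodeSection_Zset_nonempty hξ (Nat.zero_le T) ω
      rw [node_zero] at ha
      rcases (dualCone_nonneg (Nat.zero_le T) hd j).eq_or_lt with h | h
      · have h0 := eq_zero_of_mem_dualCone (Nat.zero_le T) hd h.symm
        have := hle a ha
        rw [h0, zero_dotProduct] at this
        rw [h0] at hpx
        simp only [Pi.zero_apply, zero_mul] at hpx
        linarith
      · have h1 := hy.2 ((p.1 j)⁻¹ • p.1) ⟨trivial, by simp [h.ne']⟩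
        rw [EReal.neg_le_neg_iff, hc] at h1
        have h2 : M.Zfun ξ 0 Set.univ ((p.1 j)⁻¹ • p.1) ≤ ((-((p.1 j)⁻¹ * p.2) : ℝ) : EReal) :=
          supportFun_neg_le_iff.2 fun a ha => by
            rw [neg_neg, smul_dotProduct, smul_eq_mul]
            exact mul_le_mul_of_nonneg_left (hle a ha) (inv_nonneg.2 h.le)
        have h3 := EReal.coe_le_coe_iff.1 (h1.trans h2)
        have h4 : x < (p.1 j)⁻¹ * p.2 := by
          rw [← div_eq_inv_mul, lt_div_iff₀ h]
          linarith
        linarith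
  rw [askPrice_eq_sInf hξ, hc, ← EReal.coe_neg]
  refine le_antisymm (sInf_le ⟨-c, rfl, (key _).2 le_rfl⟩) (le_sInf ?_)
  rintro _ ⟨x, rfl, hx⟩
  exact EReal.coe_le_coe_iff.2 ((key x).1 hx)

end CurrencyModel

namespace CurrencyModel

variable {Ω : Type*} [Finite Ω] [MeasurableSpace Ω] {T d : ℕ} {M : CurrencyModel Ω T d} {t : ℕ}
  {ξ : ℕ → Ω → Fin d → ℝ}

/-! ### Expectations under product weights along the tree -/

section Mean

variable {V : Type*} [AddCommGroup V] [Module ℝ V] {q : ℕ → Set Ω → ℝ} {ω : Ω}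

/-- The product of the weights along the path of `ω` after time `t`. -/
def pathWeight (M : CurrencyModel Ω T d) (q : ℕ → Set Ω → ℝ) (t : ℕ) (ω : Ω) : ℝ :=
  ∏ r ∈ Finset.Icc (t + 1) T, q r (M.node r ω)

/-- The mean of `f` over the set `μ` with respect to the path weights after time `t`. -/
def nodeMean (M : CurrencyModel Ω T d) (q : ℕ → Set Ω → ℝ) (t : ℕ) (f : Ω → V) (μ : Set Ω) : V :=
  ∑ ω ∈ (Set.toFinite μ).toFinset, M.pathWeight q t ω • f ω

variable (M) in
/-- Nonnegative weights on the nodes that sum to one over the successors of each node. -/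
structure IsTransition (q : ℕ → Set Ω → ℝ) : Prop where
  nonneg : ∀ t < T, ∀ ω, 0 ≤ q (t + 1) (M.node (t + 1) ω)
  sum_eq_one : ∀ t < T, ∀ ω, ∑ ν ∈ M.successors t (M.node t ω), q (t + 1) ν = 1

theorem pathWeight_of_lt (ht : t < T) (ω : Ω) :
    M.pathWeight q t ω = q (t + 1) (M.node (t + 1) ω) * M.pathWeight q (t + 1) ω := by
  rw [pathWeight, Finset.Icc_eq_cons_Ioc (by omega), Finset.prod_cons, pathWeight]
  congr 2
  ext r
  simp

theorem IsTransition.pathWeight_nonneg (hq : IsTransition M q) (t : ℕ) (ω : Ω) :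
    0 ≤ M.pathWeight q t ω := by
  refine Finset.prod_nonneg fun r hr => ?_
  obtain ⟨h1, h2⟩ := Finset.mem_Icc.1 hr
  obtain ⟨r, rfl⟩ : ∃ r', r = r' + 1 := ⟨r - 1, by omega⟩
  exact hq.nonneg r (by omega) ω

theorem nodeMean_congr {f g : Ω → V} (h : ∀ ω', M.node t ω' = M.node t ω → f ω' = g ω') :
    M.nodeMean q t f (M.node t ω) = M.nodeMean q t g (M.node t ω) := by
  refine Finset.sum_congr rfl fun ω' hω' => ?_
  rw [h ω' (node_eq_of_mem (by simpa using hω'))]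

theorem nodeMean_add (f g : Ω → V) (μ : Set Ω) :
    M.nodeMean q t (fun ω => f ω + g ω) μ = M.nodeMean q t f μ + M.nodeMean q t g μ := by
  simp only [nodeMean, smul_add, Finset.sum_add_distrib]

theorem nodeMean_final (f : Ω → V) (ω : Ω) : M.nodeMean q T f (M.node T ω) = f ω := by
  simp [nodeMean, node_final, pathWeight]

/-- The points of the node are grouped by successor, and the weight of the first step factors out of
the path weight. -/
theorem nodeMean_of_lt (ht : t < T) (f : Ω → V) (ω : Ω) :
    M.nodeMean q t f (M.node t ω) =
      ∑ ν ∈ M.successors t (M.node t ω), q (t + 1) ν • M.nodeMean q (t + 1) f ν := by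
  classical
  rw [nodeMean, ← Finset.sum_fiberwise_of_maps_to (t := M.successors t (M.node t ω))
    (g := M.node (t + 1)) fun ω' hω' => node_succ_mem_successors_iff.2
      (node_eq_of_mem (by simpa using hω'))]
  refine Finset.sum_congr rfl fun ν hν => ?_
  obtain ⟨ω₁, rfl, hω₁⟩ := exists_of_mem_successors hν
  rw [nodeMean, Finset.smul_sum]
  refine Finset.sum_congr ?_ fun ω₂ hω₂ => ?_
  · ext ω₂
    simp only [Finset.mem_filter, Set.Finite.mem_toFinset, mem_node_iff]
    exact ⟨fun h => h.2, fun h => ⟨(node_eq_of_le t.le_succ h).trans hω₁, h⟩⟩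
  · rw [pathWeight_of_lt ht, mul_smul, node_eq_of_mem (by simpa using hω₂)]

theorem IsTransition.nodeMean_const (hq : IsTransition M q) (ht : t ≤ T) (v : V) (ω : Ω) :
    M.nodeMean q t (fun _ => v) (M.node t ω) = v := by
  induction ht using Nat.decreasingInduction generalizing ω with
  | self => exact nodeMean_final _ ω
  | of_succ t ht ih =>
    rw [nodeMean_of_lt ht]
    have : ∀ ν ∈ M.successors t (M.node t ω),
        q (t + 1) ν • M.nodeMean q (t + 1) (fun _ => v) ν = q (t + 1) ν • v := fun ν hν => by
      obtain ⟨ω', rfl, _⟩ := exists_of_mem_successors hν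
      rw [ih]
    rw [Finset.sum_congr rfl this, ← Finset.sum_smul, hq.sum_eq_one t ht, one_smul]

theorem IsTransition.nodeMean_of_node_eq (hq : IsTransition M q) (ht : t ≤ T) {f : Ω → V}
    (hf : ∀ ω', M.node t ω' = M.node t ω → f ω' = f ω) :
    M.nodeMean q t f (M.node t ω) = f ω := by
  rw [nodeMean_congr hf, hq.nodeMean_const ht]

/-- The tower property, by descent from `s = t`, where the inner mean is constant on the node. -/
theorem IsTransition.nodeMean_nodeMean (hq : IsTransition M q) {s : ℕ} (hst : s ≤ t) (ht : t ≤ T)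
    (f : Ω → V) (ω : Ω) :
    M.nodeMean q s (fun ω => M.nodeMean q t f (M.node t ω)) (M.node s ω) =
      M.nodeMean q s f (M.node s ω) := by
  induction hst using Nat.decreasingInduction generalizing ω with
  | self => exact hq.nodeMean_of_node_eq ht fun ω' h => by rw [h]
  | of_succ s hs ih =>
    rw [nodeMean_of_lt (by omega), nodeMean_of_lt (by omega)]
    refine Finset.sum_congr rfl fun ν hν => ?_
    obtain ⟨ω', rfl, _⟩ := exists_of_mem_successors hν
    rw [ih]

end Mean

/-! ### The measure with given path weights -/

section Measure

variable {q : ℕ → Set Ω → ℝ} {Q : Measure Ω}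

theorem measurableSet (M : CurrencyModel Ω T d) (A : Set Ω) : MeasurableSet A :=
  M.filt.le T A (by rw [M.filt_final]; trivial)

theorem IsTransition.isProbabilityMeasure (hq : IsTransition M q)
    (hQ : ∀ ω, Q {ω} = ENNReal.ofReal (M.pathWeight q 0 ω)) : IsProbabilityMeasure Q := by
  have : MeasurableSingletonClass Ω := ⟨fun ω => M.measurableSet {ω}⟩
  obtain ⟨ω⟩ := M.nonempty
  constructor
  rw [← (Set.toFinite (Set.univ : Set Ω)).coe_toFinset, ← MeasureTheory.sum_measure_singleton]
  simp only [hQ]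
  rw [← ENNReal.ofReal_sum_of_nonneg fun ω _ => hq.pathWeight_nonneg 0 ω]
  have := hq.nodeMean_const (Nat.zero_le T) (1 : ℝ) ω
  rw [node_zero] at this
  simpa [nodeMean] using congrArg ENNReal.ofReal this

theorem IsTransition.integral_eq {V : Type*} [NormedAddCommGroup V] [NormedSpace ℝ V]
    [CompleteSpace V] (hq : IsTransition M q)
    (hQ : ∀ ω, Q {ω} = ENNReal.ofReal (M.pathWeight q 0 ω)) (f : Ω → V) (ω : Ω) :
    ∫ ω, f ω ∂Q = M.nodeMean q 0 f (M.node 0 ω) := by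
  have : MeasurableSingletonClass Ω := ⟨fun ω => M.measurableSet {ω}⟩
  have := hq.isProbabilityMeasure hQ
  cases nonempty_fintype Ω
  rw [integral_fintype Integrable.of_finite, nodeMean, node_zero]
  refine (Finset.sum_congr (by ext; simp) fun ω _ => ?_).symm
  rw [Measure.real, hQ, ENNReal.toReal_ofReal (hq.pathWeight_nonneg 0 ω)]

/-- A set of `𝓕_t` contains or misses each node at `t`, so its indicator passes through the node
mean and the tower property equates the integrals. -/
theorem IsTransition.condExp_ae_eq {V : Type*} [NormedAddCommGroup V] [NormedSpace ℝ V]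
    [CompleteSpace V] (hq : IsTransition M q)
    (hQ : ∀ ω, Q {ω} = ENNReal.ofReal (M.pathWeight q 0 ω)) (ht : t ≤ T) (f : Ω → V) :
    (fun ω => M.nodeMean q t f (M.node t ω)) =ᵐ[Q] Q[f | M.filt t] := by
  have : MeasurableSingletonClass Ω := ⟨fun ω => M.measurableSet {ω}⟩
  have := hq.isProbabilityMeasure hQ
  obtain ⟨ω₀⟩ := M.nonempty
  refine ae_eq_condExp_of_forall_setIntegral_eq (M.filt.le t) Integrable.of_finite
    (fun A _ _ => Integrable.of_finite) (fun A hA _ => ?_) ?_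
  · rw [← integral_indicator (M.measurableSet A), ← integral_indicator (M.measurableSet A),
      hq.integral_eq hQ _ ω₀, hq.integral_eq hQ _ ω₀,
      ← hq.nodeMean_nodeMean (Nat.zero_le t) ht (A.indicator f)]
    congr 1
    ext1 ω
    have hA' (ω' : Ω) (h : M.node t ω' = M.node t ω) : ω' ∈ A ↔ ω ∈ A :=
      ⟨@mem_of_mem_measurableAtom _ (M.filt t) _ _ (mem_node_iff.2 h.symm) _ hA,
        @mem_of_mem_measurableAtom _ (M.filt t) _ _ (mem_node_iff.2 h) _ hA⟩
    by_cases h : ω ∈ A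
    · rw [Set.indicator_of_mem h]
      exact nodeMean_congr fun ω' h' => (Set.indicator_of_mem ((hA' ω' h').2 h) _).symm
    · rw [Set.indicator_of_notMem h, ← hq.nodeMean_const ht (0 : V) ω]
      exact nodeMean_congr fun ω' h' =>
        (Set.indicator_of_notMem (fun h'' => h ((hA' ω' h').1 h'')) _).symm
  -- The candidate factors through the node map, and on a discrete space every function is
  -- measurable.
  · let _ : MeasurableSpace (Set Ω) := ⊤
    have h1 : StronglyMeasurable (fun μ : Set Ω => M.nodeMean q t f μ) := .of_discrete
    exact (h1.comp_measurable (M.measurable_node_comp t id)).aestronglyMeasurable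

end Measure

end CurrencyModel

namespace CurrencyModel

variable {Ω : Type*} [Finite Ω] [MeasurableSpace Ω] {T d : ℕ} {M : CurrencyModel Ω T d} {t : ℕ}
  {ξ : ℕ → Ω → Fin d → ℝ}

/-! ### Mixed stopping times from exercise fractions -/

section Mixed

variable {l : ℕ → Set Ω → ℝ} {χ : ℕ → Ω → ℝ}

variable (M) in
/-- `χ` exercises the fraction `l_t` of what is left at each time `t`. -/
structure IsGeneratedBy (χ : ℕ → Ω → ℝ) (l : ℕ → Set Ω → ℝ) : Prop where
  eq_mul : ∀ t ≤ T, ∀ ω, χ t ω = l t (M.node t ω) * (1 - ∑ r ∈ Finset.range t, χ r ω)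
  mem_Icc : ∀ t ≤ T, ∀ ω, l t (M.node t ω) ∈ Set.Icc (0 : ℝ) 1
  eq_one : ∀ ω, l T (M.node T ω) = 1

theorem IsGeneratedBy.remaining_succ (h : IsGeneratedBy M χ l) (ht : t ≤ T) (ω : Ω) :
    1 - ∑ r ∈ Finset.range (t + 1), χ r ω =
      (1 - l t (M.node t ω)) * (1 - ∑ r ∈ Finset.range t, χ r ω) := by
  rw [Finset.sum_range_succ, h.eq_mul t ht]
  ring

theorem IsGeneratedBy.remaining_mem (h : IsGeneratedBy M χ l) (ht : t ≤ T + 1) (ω : Ω) :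
    1 - ∑ r ∈ Finset.range t, χ r ω ∈ Set.Icc (0 : ℝ) 1 := by
  induction t with
  | zero => simp
  | succ t ih =>
    rw [h.remaining_succ (by omega)]
    have hl := h.mem_Icc t (by omega) ω
    exact unitInterval.mul_mem ⟨by linarith [hl.2], by linarith [hl.1]⟩ (ih (by omega))

theorem IsGeneratedBy.eq_of_node_eq (h : IsGeneratedBy M χ l) (ht : t ≤ T) {ω ω' : Ω}
    (hω : M.node t ω' = M.node t ω) : χ t ω' = χ t ω := by
  induction t using Nat.strong_induction_on with
  | _ t ih =>
    rw [h.eq_mul t ht, h.eq_mul t ht, hω, Finset.sum_congr rfl fun r hr => ?_]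
    have hr' := Finset.mem_range.1 hr
    exact ih r hr' (by omega) (node_eq_of_le hr'.le hω)

theorem IsGeneratedBy.isMixedStoppingTime (h : IsGeneratedBy M χ l) :
    M.IsMixedStoppingTime χ := by
  refine ⟨fun t ht => measurable_of_node_eq fun ω ω' => h.eq_of_node_eq ht, fun t ht ω => ?_,
    fun ω => ?_⟩
  · rw [h.eq_mul t ht]
    exact unitInterval.mul_mem (h.mem_Icc t ht ω) (h.remaining_mem (by omega) ω)
  · have := h.remaining_succ le_rfl ω
    rw [h.eq_one, sub_self, zero_mul, Nat.range_succ_eq_Icc_zero] at this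
    linarith

/-- Backward induction for the means of the tails of an exercised process. -/
theorem IsGeneratedBy.nodeMean_tail {V : Type*} [AddCommGroup V] [Module ℝ V]
    {q : ℕ → Set Ω → ℝ} (h : IsGeneratedBy M χ l) (hq : IsTransition M q)
    {a : ℕ → Ω → V} {b c : ℕ → Set Ω → V}
    (ha : ∀ t ≤ T, ∀ ω ω', M.node t ω' = M.node t ω → a t ω' = a t ω)
    (hT : ∀ ω, b T (M.node T ω) = a T ω)
    (hb : ∀ t < T, ∀ ω, b t (M.node t ω) =
      l t (M.node t ω) • a t ω + (1 - l t (M.node t ω)) • c t (M.node t ω))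
    (hc : ∀ t < T, ∀ ω, c t (M.node t ω) =
      ∑ ν ∈ M.successors t (M.node t ω), q (t + 1) ν • b (t + 1) ν) :
    (∀ t ≤ T, ∀ ω, M.nodeMean q t (fun ω => ∑ s ∈ Finset.Icc t T, χ s ω • a s ω) (M.node t ω) =
      (1 - ∑ r ∈ Finset.range t, χ r ω) • b t (M.node t ω)) ∧
    ∀ t < T, ∀ ω,
      M.nodeMean q t (fun ω => ∑ s ∈ Finset.Icc (t + 1) T, χ s ω • a s ω) (M.node t ω) =
      (1 - ∑ r ∈ Finset.range (t + 1), χ r ω) • c t (M.node t ω) := by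
  have step : ∀ t < T, (∀ ω, M.nodeMean q (t + 1)
      (fun ω => ∑ s ∈ Finset.Icc (t + 1) T, χ s ω • a s ω) (M.node (t + 1) ω) =
        (1 - ∑ r ∈ Finset.range (t + 1), χ r ω) • b (t + 1) (M.node (t + 1) ω)) → ∀ ω,
      M.nodeMean q t (fun ω => ∑ s ∈ Finset.Icc (t + 1) T, χ s ω • a s ω) (M.node t ω) =
      (1 - ∑ r ∈ Finset.range (t + 1), χ r ω) • c t (M.node t ω) := by
    intro t ht ih ω
    rw [nodeMean_of_lt ht, hc t ht, Finset.smul_sum]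
    refine Finset.sum_congr rfl fun ν hν => ?_
    obtain ⟨ω', rfl, hω'⟩ := exists_of_mem_successors hν
    rw [ih, smul_comm]
    congr 2
    -- What remains after date `t` is known at `t`, hence is the same at all successors.
    refine Finset.sum_congr rfl fun r hr => ?_
    have hr' : r ≤ t := by simpa [Nat.lt_succ_iff] using hr
    exact h.eq_of_node_eq (by omega) (node_eq_of_le hr' hω')
  have main : ∀ t ≤ T, ∀ ω,
      M.nodeMean q t (fun ω => ∑ s ∈ Finset.Icc t T, χ s ω • a s ω) (M.node t ω) =
      (1 - ∑ r ∈ Finset.range t, χ r ω) • b t (M.node t ω) := by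
    intro t ht
    induction ht using Nat.decreasingInduction with
    | self =>
      intro ω
      rw [nodeMean_final, Finset.Icc_self, Finset.sum_singleton, hT, h.eq_mul T le_rfl, h.eq_one,
        one_mul]
    | of_succ t ht ih =>
      intro ω
      have hsplit (ω : Ω) : ∑ s ∈ Finset.Icc t T, χ s ω • a s ω =
          χ t ω • a t ω + ∑ s ∈ Finset.Icc (t + 1) T, χ s ω • a s ω := by
        rw [Finset.Icc_eq_cons_Ioc ht.le, Finset.sum_cons]
        exact congrArg _ (Finset.sum_congr (by ext; simp) fun _ _ => rfl)
      simp only [hsplit]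
      rw [nodeMean_add, step t ht ih, hq.nodeMean_of_node_eq ht.le fun ω' hω' => by
        rw [h.eq_of_node_eq ht.le hω', ha t ht.le _ _ hω'], h.remaining_succ ht.le,
        h.eq_mul t ht.le, hb t ht, smul_add, smul_smul, smul_smul, mul_comm, mul_comm (1 - l t _)]
  exact ⟨main, fun t ht => step t ht (main (t + 1) ht)⟩

end Mixed

/-! ### Outputs of the procedure -/

theorem IsProcedureOutput.isDualTriple_and_askPrice (hξ : M.IsAdapted ξ) {j : Fin d}
    {χ : ℕ → Ω → ℝ} {Q : Measure Ω} {S : ℕ → Ω → Fin d → ℝ}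
    (h : M.IsProcedureOutput ξ j χ Q S) :
    M.IsDualTriple j χ Q S ∧ M.askPrice ξ j =
      ((∫ ω, evalAt T χ (fun t ω' => ξ t ω' ⬝ᵥ S t ω') ω ∂Q : ℝ) : EReal) := by
  obtain ⟨y, x, s, l, q, hinit, hstep, hfinal, hS, hQ, hχ⟩ := h
  have hst (t : ℕ) (ht : t < T) (ω : Ω) := hstep t ht (M.node t ω) ⟨ω, rfl⟩
  have hfin (ω : Ω) := hfinal (M.node T ω) ⟨ω, rfl⟩
  have hy : ∀ t ≤ T, ∀ ω, y t (M.node t ω) ∈ sigmaSet j (M.dualCone t (M.node t ω)) := by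
    intro t ht ω
    cases t with
    | zero => rw [node_zero]; exact hinit.1
    | succ t => exact (hst t ht ω).y'_mem _ (node_succ_mem_successors_iff.2 rfl)
  have hs : ∀ t ≤ T, ∀ ω, S t ω ∈ sigmaSet j (M.dualCone t (M.node t ω)) := by
    intro t ht ω
    rw [hS t ht]
    rcases ht.lt_or_eq with h | rfl
    · exact (hst t h ω).S_mem
    · rw [(hfin ω).2.2]
      exact hy _ le_rfl ω
  have hq : IsTransition M q := ⟨fun t ht ω =>
    ((hst t ht ω).q_mem _ (node_succ_mem_successors_iff.2 rfl)).1, fun t ht ω => (hst t ht ω).sum_q⟩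
  have hgen : IsGeneratedBy M χ l := ⟨hχ, fun t ht ω => by
    rcases ht.lt_or_eq with h | rfl
    · exact (hst t h ω).l_mem
    · rw [(hfin ω).1]
      simp, fun ω => (hfin ω).1⟩
  have hSnode : ∀ t ≤ T, ∀ ω ω', M.node t ω' = M.node t ω → S t ω' = S t ω :=
    fun t ht ω ω' hω => by rw [hS t ht, hS t ht, hω]
  have hprob := hq.isProbabilityMeasure hQ
  have hx (t : ℕ) (ht : t < T) (ω : Ω) : x t (M.node t ω) ∈ M.dualCone t (M.node t ω) :=
    mem_dualCone_of_Vfun_lt_top hξ ht (hst t ht ω).x_mem.1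
  -- Here `a = S`, `b = y` and `c = x`: the mean of the tail of `S` after `t` is the remaining
  -- fraction times `x t`.
  have htail := (hgen.nodeMean_tail hq hSnode
    (fun ω => by rw [hS T le_rfl, (hfin ω).2.2])
    (fun t ht ω => by rw [hS t ht.le]; exact (hst t ht ω).y_eq)
    (fun t ht ω => (hst t ht ω).x_eq)).2
  refine ⟨⟨hgen.isMixedStoppingTime, hprob, fun t ht => mem_portfolios.2 (hSnode t ht),
    fun t ht ω => ⟨(hs t ht ω).1, fun h0 => ?_⟩, fun t ht => ?_, fun t ht ω => (hs t ht ω).2⟩, ?_⟩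
  · have := (hs t ht ω).2
    rw [Set.mem_singleton_iff.1 h0] at this
    simp at this
  · filter_upwards [hq.condExp_ae_eq hQ ht (tailSum T χ S (t + 1))] with ω hω
    rw [← hω]
    rcases ht.lt_or_eq with h | rfl
    · have := htail t h ω
      change M.nodeMean q t (tailSum T χ S (t + 1)) (M.node t ω) = _ at this
      rw [this]
      exact smul_mem_dualCone (hx t h ω) (hgen.remaining_mem (by omega) ω).1
    -- The tail after `T` is empty, and `0` belongs to every dual cone.
    · rw [nodeMean_final]
      simp [tailSum, dualCone, polarNeg]
  · have hZ (t : ℕ) (ht : t ≤ T) (ω : Ω) := exists_Zfun_eq_coe (ξ := ξ) hξ ht (hy t ht ω).1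
    have hW (t : ℕ) (ht : t < T) (ω : Ω) := exists_Wfun_eq_coe (ξ := ξ) hξ ht (hx t ht ω)
    -- The same recursion for payoffs. The minus signs undo the reflection in the support functions,
    -- and `toReal` loses nothing since all the values involved are finite.
    have hval := (hgen.nodeMean_tail hq (a := fun t ω => ξ t ω ⬝ᵥ S t ω)
      (b := fun t μ => -(M.Zfun ξ t μ (y t μ)).toReal)
      (c := fun t μ => -(M.Wfun ξ t μ (x t μ)).toReal)
      (fun t ht ω ω' hω => by
        rw [hSnode t ht _ _ hω, mem_portfolios.1 (hξ t ht) _ _ hω])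
      (fun ω => by
        have hU := Ufun_eq hξ le_rfl (hy T le_rfl ω).1
        rw [Zfun, Zset_final, ← Ufun, hU, EReal.toReal_coe, neg_neg, hS T le_rfl, (hfin ω).2.2,
          dotProduct_comm])
      (fun t ht ω => by
        have hU := Ufun_eq hξ ht.le (hs t ht.le ω).1
        have hZeq := (hst t ht ω).Z_eq
        obtain ⟨w, hw⟩ := hW t ht ω
        rw [(hst t ht ω).V_eq, ← hS t ht.le, hU, hw, ← EReal.coe_mul, ← EReal.coe_mul,
          ← EReal.coe_add] at hZeq
        rw [hZeq, hw, EReal.toReal_coe, EReal.toReal_coe, dotProduct_comm]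
        simp only [smul_eq_mul]
        ring)
      (fun t ht ω => by
        rw [(hst t ht ω).W_eq]
        have : ∀ ν ∈ M.successors t (M.node t ω),
            (q (t + 1) ν : EReal) * M.Zfun ξ (t + 1) ν (y (t + 1) ν) =
              ((q (t + 1) ν * (M.Zfun ξ (t + 1) ν (y (t + 1) ν)).toReal : ℝ) : EReal) := by
          intro ν hν
          obtain ⟨ω', rfl, _⟩ := exists_of_mem_successors hν
          obtain ⟨z, hz⟩ := hZ (t + 1) ht ω'
          rw [hz, EReal.coe_mul, EReal.toReal_coe]
        rw [Finset.sum_congr rfl this, ← ereal_coe_sum, EReal.toReal_coe,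
          ← Finset.sum_neg_distrib]
        simp only [smul_eq_mul, mul_neg])).1 0 (Nat.zero_le T)
    obtain ⟨ω⟩ := M.nonempty
    obtain ⟨z, hz⟩ := hZ 0 (Nat.zero_le T) ω
    have hval0 := hval ω
    rw [hz] at hval0
    rw [hinit.askPrice_eq hξ, hq.integral_eq hQ _ ω]
    rw [node_zero] at hz hval0 ⊢
    rw [hz, ← EReal.coe_neg, EReal.coe_eq_coe_iff]
    change -z = M.nodeMean q 0 (fun ω => ∑ s ∈ Finset.Icc 0 T, χ s ω * (ξ s ω ⬝ᵥ S s ω)) Set.univ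
    simpa using hval0.symm

/-- The recursive procedure has an output. -/
theorem exists_isProcedureOutput (hM : M.NoArbitrage) (hξ : M.IsAdapted ξ) (j : Fin d) :
    ∃ χ Q S, M.IsProcedureOutput ξ j χ Q S := by
  classical
  cases nonempty_fintype Ω
  have : MeasurableSingletonClass Ω := ⟨fun ω => M.measurableSet {ω}⟩
  obtain ⟨y₀, hy₀⟩ := exists_isInitialChoice hM hξ j
  have next : ∀ t (y : Set Ω → Fin d → ℝ), ∃ (l : Set Ω → ℝ) (x S : Set Ω → Fin d → ℝ)
      (q : Set Ω → ℝ) (y' : Set Ω → Fin d → ℝ), t < T →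
      (∀ μ ∈ M.nodes t, y μ ∈ sigmaSet j (M.dualCone t μ)) →
      ∀ μ ∈ M.nodes t, M.IsStep ξ j t μ (y μ) (l μ) (x μ) (S μ) q y' := by
    intro t y
    by_cases h : t < T ∧ ∀ μ ∈ M.nodes t, y μ ∈ sigmaSet j (M.dualCone t μ)
    swap
    · exact ⟨0, 0, 0, 0, 0, fun h1 h2 => absurd ⟨h1, h2⟩ h⟩
    have key : ∀ μ ∈ M.nodes t, ∃ l x S q y', M.IsStep ξ j t μ (y μ) l x S q y' :=
      fun μ hμ => exists_isStep hM hξ h.1 hμ (h.2 μ hμ)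
    choose! l x S q y' hstep using key
    -- Weights and vectors were chosen separately for each `μ`, but the step needs functions of the
    -- successor alone. A successor determines its parent, so the choices fit together.
    let parent : Set Ω → Set Ω := fun ν => if h : ν.Nonempty then M.node t h.some else ∅
    have hpar : ∀ μ ∈ M.nodes t, ∀ ν ∈ M.successors t μ, parent ν = μ := by
      rintro _ ⟨ω, rfl⟩ ν hν
      obtain ⟨ω', rfl, hω'⟩ := exists_of_mem_successors hν
      have hne : (M.node (t + 1) ω').Nonempty := ⟨ω', M.mem_node_self _ _⟩
      simp only [parent, dif_pos hne]
      exact (node_eq_of_le t.le_succ (node_eq_of_mem hne.some_mem)).trans hω'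
    refine ⟨l, x, S, fun ν => q (parent ν) ν, fun ν => y' (parent ν) ν, fun _ _ μ hμ => ?_⟩
    obtain ⟨h1, h2, h3, h4, h5, h6, h7, h8, h9, h10, h11⟩ := hstep μ hμ
    refine ⟨h1, h2, h3, h4, h5, fun ν hν => ?_, fun ν hν => ?_, h8, ?_, ?_, ?_⟩
    · rw [hpar μ hμ ν hν]; exact h6 ν hν
    · rw [hpar μ hμ ν hν]; exact h7 ν hν
    · rw [h9]
      exact Finset.sum_congr rfl fun ν hν => by rw [hpar μ hμ ν hν]
    · refine h10.trans (Finset.sum_congr rfl fun ν hν => by rw [hpar μ hμ ν hν])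
    · rw [← h11]
      exact Finset.sum_congr rfl fun ν hν => by rw [hpar μ hμ ν hν]
  choose l x S q y' hstep using next
  -- The constant start is harmless: `Ω` is the only node at time `0`.
  let Y : ℕ → Set Ω → Fin d → ℝ := fun t => Nat.rec (fun _ => y₀) (fun t y => y' t y) t
  have hY : ∀ t ≤ T, ∀ μ ∈ M.nodes t, Y t μ ∈ sigmaSet j (M.dualCone t μ) := by
    intro t
    induction t with
    | zero =>
      rintro _ _ ⟨ω, rfl⟩
      rw [node_zero]
      exact hy₀.1
    | succ t ih =>
      rintro ht _ ⟨ω, rfl⟩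
      exact (hstep t (Y t) ht (ih (by omega)) (M.node t ω) ⟨ω, rfl⟩).y'_mem _
        (node_succ_mem_successors_iff.2 rfl)
  let L : ℕ → Set Ω → ℝ := fun t μ => if t < T then l t (Y t) μ else 1
  let X : ℕ → Set Ω → Fin d → ℝ := fun t μ => if t < T then x t (Y t) μ else Y t μ
  let s : ℕ → Set Ω → Fin d → ℝ := fun t μ => if t < T then S t (Y t) μ else Y t μ
  -- Weights are indexed by the date of arrival, one later than the step that chooses them.
  let p : ℕ → Set Ω → ℝ := fun t => q (t - 1) (Y (t - 1))
  -- The remaining fraction in product form, which defines `χ` without a recursion on its own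
  -- earlier values.
  let κ : ℕ → Ω → ℝ := fun t ω => ∏ r ∈ Finset.range t, (1 - L r (M.node r ω))
  have hκ (t : ℕ) (ω : Ω) :
      κ t ω = 1 - ∑ r ∈ Finset.range t, L r (M.node r ω) * κ r ω := by
    induction t with
    | zero => simp [κ]
    | succ t ih =>
      rw [Finset.sum_range_succ, ← sub_sub, ← ih]
      simp only [κ, Finset.prod_range_succ]
      ring
  refine ⟨fun t ω => L t (M.node t ω) * κ t ω,
    ∑ ω, ENNReal.ofReal (M.pathWeight p 0 ω) • Measure.dirac ω, fun t ω => s t (M.node t ω),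
    Y, X, s, L, p, hy₀, fun t ht μ hμ => ?_, fun μ hμ => by simp [L, X, s], fun t ht ω => rfl,
    fun ω => ?_, fun t ht ω => ?_⟩
  · simpa [L, X, s, ht, p] using hstep t (Y t) ht (hY t ht.le) μ hμ
  · rw [Measure.finsetSum_apply]
    simp [Set.indicator_apply, pathWeight]
  · exact congrArg _ (hκ t ω)

end CurrencyModel

end

/-! ### The main theorem -/

open CurrencyModel in
theorem mainTheorem6 {Ω : Type*} [Finite Ω] [MeasurableSpace Ω] {T d : ℕ}
    (M : CurrencyModel Ω T d) (hM : M.NoArbitrage)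
    (ξ : ℕ → Ω → Fin d → ℝ) (hξ : M.IsAdapted ξ) (j : Fin d) :
    -- the price is the maximum of `-Z^ad_0` over `σ_j(ℝ^d)`
    IsGreatest (M.dualValues ξ j) (M.askPrice ξ j) ∧
    -- it is the expectation for some dual triple produced by the recursive procedure
    (∃ (χ : ℕ → Ω → ℝ) (Q : Measure Ω) (S : ℕ → Ω → Fin d → ℝ),
      M.IsProcedureOutput ξ j χ Q S ∧ M.IsDualTriple j χ Q S ∧
      M.askPrice ξ j = ((∫ ω, evalAt T χ (fun t ω' => ξ t ω' ⬝ᵥ S t ω') ω ∂Q : ℝ) : EReal)) ∧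
    -- the procedure can be started, each of its steps can be carried out whatever was chosen
    -- before, and each of its outputs is as required
    (∃ y, M.IsInitialChoice ξ j y) ∧
    (∀ t < T, ∀ μ ∈ M.nodes t, ∀ y ∈ sigmaSet j (M.dualCone t μ),
      ∃ l x S q y', M.IsStep ξ j t μ y l x S q y') ∧
    (∀ (χ : ℕ → Ω → ℝ) (Q : Measure Ω) (S : ℕ → Ω → Fin d → ℝ),
      M.IsProcedureOutput ξ j χ Q S → M.IsDualTriple j χ Q S ∧
      M.askPrice ξ j = ((∫ ω, evalAt T χ (fun t ω' => ξ t ω' ⬝ᵥ S t ω') ω ∂Q : ℝ) : EReal)) := by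
  obtain ⟨y, hy⟩ := exists_isInitialChoice hM hξ j
  obtain ⟨χ, Q, S, h⟩ := exists_isProcedureOutput hM hξ j
  refine ⟨?_, ⟨χ, Q, S, h, h.isDualTriple_and_askPrice hξ⟩, ⟨y, hy⟩,
    fun t ht μ hμ y hy => exists_isStep hM hξ ht hμ hy,
    fun χ Q S h => h.isDualTriple_and_askPrice hξ⟩
  rw [hy.askPrice_eq hξ]
  refine ⟨⟨y, ⟨trivial, hy.1.2⟩, rfl⟩, ?_⟩
  rintro _ ⟨s, hs, rfl⟩
  exact hy.2 s hs
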